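/- **Setting.** For each $n$ let $(Z_1,X_1),\dots,(Z_n,X_n)$ be i.i.d. with law $\mathbb P_n$, where $X_i\in\mathbb R^{d}$; $\mathbb E$ and $\|\cdot\|_{\mathbb P,2}$ refer to $\mathbb P_n$, $\mathcal X$ is the support of $X_i$, and the population objects below (the true nuisance function $\eta_0$, $V_0$, $g_\ast$, $g_k$, $U$, $\sigma_v^2$) may depend on $n$ through $\mathbb P_n$ (a constant sequence $\mathbb P_n=\mathbb P$ is allowed); constants in the conditions are uniform in $n$. Let $\psi^{+},\psi^{-}\ge 0$ and $\overline\psi$ be weights depending on $z$ and on a nuisance function $\eta$ in a set $\mathcal H$ of measurable functions $\mathbb R^d\to\mathbb R^r$; put $\psi_1=\overline\psi-\psi^+$, $\psi_0=\overline\psi-\psi^-$, $$V(g)=\mathbb E[\psi_1(Z,\eta_0)\mathbf 1\{g(X)\ge 0\}+\psi_0(Z,\eta_0)\mathbf 1\{g(X)<0\}],\qquad V_0=\sup_g V(g),$$ the supremum being over all measurable $g$. Let $\phi:\mathbb R\to\mathbb R$ and let $g_\ast$ minimize $L^\ast(g)=\mathbb E[\psi^+(Z,\eta_0)\phi(-g(X))+\psi^-(Z,\eta_0)\phi(g(X))]$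 over the measurable $g$ (at which it is finite). Let $\mathcal G_k$ be the span of the first $k=k_n$ elements of a sequence of measurable functions $p_1,p_2,\dots$ Split $\{1,\dots,n\}$ into a fixed number $m$ of folds with sizes of the same order; for each fold $\ell$ let $\widehat\eta_{(\ell)}$ be an estimator of $\eta_0$ computed from the observations outside fold $\ell$, let $\ell(i)$ be the fold of $i$, and let $\widehat g$ be a real-valued function estimated from the full sample. Put $$\widehat V_n(\widehat g)=\frac1n\sum_{i=1}^n\big[\psi_1(Z_i,\widehat\eta_{(\ell(i))})\mathbf 1\{-\widehat g(X_i)<0\}+\psi_0(Z_i,\widehat\eta_{(\ell(i))})\mathbf 1\{\widehat g(X_i)<0\}\big],$$ $$\widehat s_{L,i}=\psi_1(Z_i,\widehat\eta_{(\ell(i))})\mathbf 1\{\widehat g(X_i)\ge0\}+\psi_0(Z_i,\widehat\eta_{(\ell(i))})\mathbf 1\{\widehat g(X_i)<0\}-\widehat V_n(\widehat g).$$ **Conditions.** 1. $\mathbb E[\psi^+(Z,\eta_0)+\psi^-(Z,\eta_0)]$ is bounded, and $\mathbb E[\psi^+(Z,\eta_0)\mid X]\ne\mathbb E[\psi^-(Z,\eta_0)\mid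 X]$ a.s. 2. $\phi$ is strictly convex and twice continuously differentiable, with $\phi'(0)<0$. 3. $g_k\in\mathcal G_k$ minimizes $\sup_{x\in\mathcal X}|g_\ast(x)-g(x)|$ over $g\in\mathcal G_k$; $\sup_{x\in\mathcal X}|g_\ast(x)-g_k(x)|=o(n^{-1/2})$ and $\sup_{x\in\mathcal X}|\widehat g(x)-g_k(x)|=o_p(n^{-1/4})$. 4. For some $\delta>0$, $U=\mathbb E[\psi_1(Z,\eta_0)\mid X]-\mathbb E[\psi_0(Z,\eta_0)\mid X]$ has a continuous density on $[-\delta,\delta]$ ($\delta$ and a bound of this density being uniform in $n$). 5. For each $\ell$, $\|\widehat\eta_{(\ell)}-\eta_0\|_{\mathbb P,2}=o_p(n^{-1/4})$, and there are sets $\mathcal T_n\subseteq\mathcal H$ containing $\eta_0$, with $\sup_{\eta\in\mathcal T_n}\|\eta-\eta_0\|_{\mathbb P,2}\to0$, such that $\widehat\eta_{(\ell)}\in\mathcal T_n$ with probability tending to one and, with $D_1(\eta)=(\psi_1(Z,\eta)-\psi_1(Z,\eta_0))\mathbf 1\{-g_k(X)<0\}$ and $D_0(\eta)=(\psi_0(Z,\eta)-\psi_0(Z,\eta_0))\mathbf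 1\{g_k(X)<0\}$, for $j=0,1$, $$\sqrt n\sup_{\eta\in\mathcal T_n}|\mathbb E[D_j(\eta)]|=o(1),\qquad \sqrt n\sup_{\eta\in\mathcal T_n}(\mathbb E|D_j(\eta)|^2)^{1/2}=o(1).$$ 6. For $j=0,1$, $\mathbb E|\psi_j(Z,\eta)|^q$ is bounded uniformly in $\eta\in\mathcal H$ for some $q>4$, and $\mathbb E[\psi_j(Z,\eta_0)\mid X]$ is a.s. bounded. **Conclusion.** Let $\delta_1,\dots,\delta_n$ be i.i.d. standard Gaussian, independent of the data, and let $\widetilde Z_n=\mathbb G_n[\widehat s_{L}\,\delta]=\sqrt n(\mathbb E_n-\mathbb E)[\widehat s_L\,\delta]$ be the bootstrapped score, where $\mathbb E_n$ is the average over the sample and the estimates are held fixed in $\mathbb E$ (so that $\mathbb E[\widehat s_L\,\delta]=0$ and $\widetilde Z_n=n^{-1/2}\sum_i\widehat s_{L,i}\delta_i$). Let $$\sigma_v^2=\mathbb E[s_L^2],\qquad s_L=\psi_1(Z,\eta_0)\mathbf 1\{g_\ast(X)\ge0\}+\psi_0(Z,\eta_0)\mathbf 1\{g_\ast(X)<0\}-V_0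 .$$ Then $\widetilde Z_n\to_d\mathcal N(0,\sigma_v^2)$. If $\sigma_v^2$ varies with $n$, this means that $\mathbb E f(\widetilde Z_n)-\int f\,d\mathcal N(0,\sigma_v^2)\to0$ for all bounded continuous $f$ (so that $\widetilde Z_n\to_d\mathcal N(0,v)$ whenever $\sigma_v^2\to v$). The convergence also holds conditionally on the data, in probability: for all bounded continuous $f$, $\mathbb E[f(\widetilde Z_n)\mid \text{data}]-\int f\,d\mathcal N(0,\sigma_v^2)\to0$ in probability. -/

import Mathlib

open MeasureTheory ProbabilityTheory Filter Topology
open scoped ENNReal NNReal BoundedContinuousFunction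

noncomputable section

namespace PolicyValue

/-- Euclidean space `ℝ^d`. -/
abbrev Vec (d : ℕ) := EuclideanSpace ℝ (Fin d)

/-- One observation `(Z, X)`, where the covariate `X` takes values in `ℝ^d`. -/
abbrev Obs (𝒵 : Type*) (d : ℕ) := 𝒵 × Vec d

/-! ### Population objects -/

/-- The weight functions `ψ⁺, ψ⁻, ψ̄` of an observation `z` and a nuisance function
`η : ℝ^d → ℝ^r`. -/
structure Weights (𝒵 : Type*) (d r : ℕ) where
  psiPlus : 𝒵 → (Vec d → Vec r) → ℝ
  psiMinus : 𝒵 → (Vec d → Vec r) → ℝ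
  psiBar : 𝒵 → (Vec d → Vec r) → ℝ

variable {𝒵 : Type*} [MeasurableSpace 𝒵] {d r m : ℕ}

/-- `ψ₁ = ψ̄ - ψ⁺`. -/
def Weights.psi1 {𝒵 : Type*} {d r : ℕ} (W : Weights 𝒵 d r) (z : 𝒵) (η : Vec d → Vec r) : ℝ :=
  W.psiBar z η - W.psiPlus z η

/-- `ψ₀ = ψ̄ - ψ⁻`. -/
def Weights.psi0 {𝒵 : Type*} {d r : ℕ} (W : Weights 𝒵 d r) (z : 𝒵) (η : Vec d → Vec r) : ℝ :=
  W.psiBar z η - W.psiMinus z η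

/-- `ψ₁(z, η) 1{g(x) ≥ 0} + ψ₀(z, η) 1{g(x) < 0}` at `o = (z, x)`. -/
def gain {𝒵 : Type*} {d r : ℕ} (W : Weights 𝒵 d r) (η : Vec d → Vec r) (g : Vec d → ℝ)
    (o : Obs 𝒵 d) : ℝ :=
  W.psi1 o.1 η * (if 0 ≤ g o.2 then 1 else 0) + W.psi0 o.1 η * (if g o.2 < 0 then 1 else 0)

/-- The policy value `V(g) = E[ψ₁(Z, η) 1{g(X) ≥ 0} + ψ₀(Z, η) 1{g(X) < 0}]`. -/
def value (W : Weights 𝒵 d r) (P : Measure (Obs 𝒵 d)) (η : Vec d → Vec r) (g : Vec d → ℝ) : ℝ :=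
  ∫ o, gain W η g o ∂P

/-- The optimal policy value `V₀ = sup_g V(g)` over all measurable policy functions. -/
def optimalValue (W : Weights 𝒵 d r) (P : Measure (Obs 𝒵 d)) (η : Vec d → Vec r) : ℝ :=
  ⨆ g : {g : Vec d → ℝ // Measurable g}, value W P η g.1

/-- The score `s_L(Z, η, g) = ψ₁(Z, η) 1{g(X) ≥ 0} + ψ₀(Z, η) 1{g(X) < 0} - V₀`. -/
def score (W : Weights 𝒵 d r) (P : Measure (Obs 𝒵 d)) (η : Vec d → Vec r) (g : Vec d → ℝ)
    (o : Obs 𝒵 d) : ℝ :=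
  gain W η g o - optimalValue W P η

/-- `σ_v² = E[s_L(Z, η, g)²]`. -/
def scoreVar (W : Weights 𝒵 d r) (P : Measure (Obs 𝒵 d)) (η : Vec d → Vec r)
    (g : Vec d → ℝ) : ℝ :=
  ∫ o, score W P η g o ^ 2 ∂P

/-- The surrogate loss `ψ⁺(z, η) φ(-g(x)) + ψ⁻(z, η) φ(g(x))` at `o = (z, x)`. -/
def surrogateLoss {𝒵 : Type*} {d r : ℕ} (W : Weights 𝒵 d r) (φ : ℝ → ℝ) (η : Vec d → Vec r)
    (g : Vec d → ℝ) (o : Obs 𝒵 d) : ℝ :=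
  W.psiPlus o.1 η * φ (-g o.2) + W.psiMinus o.1 η * φ (g o.2)

/-- `g` minimizes the surrogate risk `L*(g) = E[ψ⁺(Z, η) φ(-g(X)) + ψ⁻(Z, η) φ(g(X))]` over the
measurable functions (at which that risk is finite). -/
structure IsSurrogatePolicy (W : Weights 𝒵 d r) (φ : ℝ → ℝ) (P : Measure (Obs 𝒵 d))
    (η : Vec d → Vec r) (g : Vec d → ℝ) : Prop where
  measurable : Measurable g
  integrable : Integrable (surrogateLoss W φ η g) P
  minimal : ∀ h : Vec d → ℝ, Measurable h → Integrable (surrogateLoss W φ η h) P →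
    ∫ o, surrogateLoss W φ η g o ∂P ≤ ∫ o, surrogateLoss W φ η h o ∂P

/-- `E[f(Z) | X]`, as a function of `(Z, X)` that depends on `X` only. -/
def condMean (P : Measure (Obs 𝒵 d)) (f : 𝒵 → ℝ) : Obs 𝒵 d → ℝ :=
  P[fun o => f o.1 | MeasurableSpace.comap (Prod.snd : Obs 𝒵 d → Vec d) inferInstance]

/-- The support of the covariate `X`. -/
def covSupport (P : Measure (Obs 𝒵 d)) : Set (Vec d) := (P.map Prod.snd).support

/-- `sup_x |f(x) - g(x)|` over the support of `X` (possibly infinite). -/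
def supDist (P : Measure (Obs 𝒵 d)) (f g : Vec d → ℝ) : ℝ≥0∞ :=
  ⨆ x ∈ covSupport P, ENNReal.ofReal |f x - g x|

/-- `‖η - η'‖_{P,2} = (E‖η(X) - η'(X)‖²)^{1/2}` with the Euclidean norm inside. -/
def l2Dist (P : Measure (Obs 𝒵 d)) (η η' : Vec d → Vec r) : ℝ≥0∞ :=
  eLpNorm (fun x => η x - η' x) 2 (P.map Prod.snd)

/-- The sieve space `𝒢_k` spanned by the first `k` basis functions. -/
def sieve (p : ℕ → Vec d → ℝ) (k : ℕ) : Set (Vec d → ℝ) :=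
  {g | ∃ β : Fin k → ℝ, g = fun x => ∑ j : Fin k, β j * p j x}

/-! ### Estimators -/

/-- For every sample size `n`: a (deterministic) partition of the `n` indices into `m` folds,
for every fold an estimator of the nuisance function computed from the observations outside that
fold, and an estimator of the surrogate policy function computed from the full sample. -/
structure Estimators (𝒵 : Type*) (d r m : ℕ) where
  fold : ∀ n : ℕ, Fin n → Fin m
  etaHat : ∀ (n : ℕ) (l : Fin m), ({i : Fin n // fold n i ≠ l} → Obs 𝒵 d) → Vec d → Vec r
  gHat : ∀ n : ℕ, (Fin n → Obs 𝒵 d) → Vec d → ℝ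

/-- The nuisance estimate for fold `l`, computed from the sample `w` without fold `l`. -/
def Estimators.eta {𝒵 : Type*} {d r m : ℕ} (S : Estimators 𝒵 d r m) (n : ℕ) (l : Fin m)
    (w : Fin n → Obs 𝒵 d) : Vec d → Vec r :=
  S.etaHat n l fun i => w i.1

/-- The folds are approximately balanced: their sizes are of the same order. -/
def Estimators.Balanced {𝒵 : Type*} {d r m : ℕ} (S : Estimators 𝒵 d r m) : Prop :=
  ∃ C : ℝ, ∀ᶠ n : ℕ in atTop, ∀ l l' : Fin m,
    (Fintype.card {i : Fin n // S.fold n i = l} : ℝ) ≤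
      C * Fintype.card {i : Fin n // S.fold n i = l'}

/-- The cross-fitted plug-in estimator `V̂_n(ĝ)` of the optimal policy value. -/
def valueHat {𝒵 : Type*} {d r m : ℕ} (W : Weights 𝒵 d r) (S : Estimators 𝒵 d r m) (n : ℕ)
    (w : Fin n → Obs 𝒵 d) : ℝ :=
  (1 / (n : ℝ)) * ∑ l : Fin m, ∑ i : {i : Fin n // S.fold n i = l},
    (W.psi1 (w i.1).1 (S.eta n l w) * (if -S.gHat n w (w i.1).2 < 0 then 1 else 0)
      + W.psi0 (w i.1).1 (S.eta n l w) * (if S.gHat n w (w i.1).2 < 0 then 1 else 0))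

/-- The estimated score `ŝ_L(·, η̂_(ℓ(i)), ĝ)` for the `i`-th observation, as a function of the
point `o = (z, x)`; the estimates are computed from the sample `w`. -/
def scoreHat {𝒵 : Type*} {d r m : ℕ} (W : Weights 𝒵 d r) (S : Estimators 𝒵 d r m) (n : ℕ)
    (w : Fin n → Obs 𝒵 d) (i : Fin n) (o : Obs 𝒵 d) : ℝ :=
  gain W (S.eta n (S.fold n i) w) (S.gHat n w) o - valueHat W S n w

/-- The empirical process `𝔾_n[f] = √n (𝔼_n[f] - 𝔼[f])` of the points `y_1, …, y_n` under the
sampling distribution `μ`; the integrand `f_i` may depend on the index. -/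
def empProcess {Y : Type*} [MeasurableSpace Y] (μ : Measure Y) (n : ℕ) (f : Fin n → Y → ℝ)
    (y : Fin n → Y) : ℝ :=
  √(n : ℝ) * ((1 / (n : ℝ)) * ∑ i, f i (y i) - (1 / (n : ℝ)) * ∑ i, ∫ t, f i t ∂μ)

/-- The score bootstrap statistic `Z̃_n = 𝔾_n[ŝ_L(Z_i, η̂_(ℓ(i)), ĝ) δ_i]` at the sample `w` and
the multipliers `δ`; in the centering term, which is zero, the estimates are held fixed. -/
def bootStat (W : Weights 𝒵 d r) (S : Estimators 𝒵 d r m) (P : Measure (Obs 𝒵 d)) (n : ℕ)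
    (w : Fin n → Obs 𝒵 d) (δ : Fin n → ℝ) : ℝ :=
  empProcess (P.prod (gaussianReal 0 1)) n (fun i y => scoreHat W S n w i y.1 * y.2)
    (fun i => (w i, δ i))

/-- The law of an i.i.d. sample of size `n` from `P`. -/
abbrev sampleLaw (P : Measure (Obs 𝒵 d)) (n : ℕ) : Measure (Fin n → Obs 𝒵 d) :=
  Measure.pi fun _ => P

/-- The law of `n` i.i.d. standard Gaussian multipliers. -/
abbrev multiplierLaw (n : ℕ) : Measure (Fin n → ℝ) :=
  Measure.pi fun _ => gaussianReal 0 1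

/-- `T_n = o_p(a_n)` for nonnegative statistics `T_n` of i.i.d. samples of size `n` from `P_n`
(with respect to outer probability if `T_n` is not measurable). -/
def IsLittleOp (P : ℕ → Measure (Obs 𝒵 d)) (T : ∀ n : ℕ, (Fin n → Obs 𝒵 d) → ℝ≥0∞)
    (a : ℕ → ℝ) : Prop :=
  ∀ ε : ℝ, 0 < ε →
    Tendsto (fun n => sampleLaw (P n) n {w | ENNReal.ofReal (ε * a n) < T n w}) atTop (𝓝 0)

/-! ### Assumptions, for a sequence of data generating processes `P_n` with true nuisance
functions `η_{0,n}`, surrogate policies `g_{*,n}` and sieve approximations `g_{k,n}`. All constants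
are uniform in `n`. -/

/-- Measurability of the weights, the basis functions and the estimators. -/
structure MeasurabilityConditions (W : Weights 𝒵 d r) (H : Set (Vec d → Vec r))
    (p : ℕ → Vec d → ℝ) (S : Estimators 𝒵 d r m) : Prop where
  nuisance : ∀ η ∈ H, Measurable η
  psiPlus : ∀ η ∈ H, Measurable fun z => W.psiPlus z η
  psiMinus : ∀ η ∈ H, Measurable fun z => W.psiMinus z η
  psiBar : ∀ η ∈ H, Measurable fun z => W.psiBar z η
  basis : ∀ j, Measurable (p j)
  psi1Hat : ∀ (n : ℕ) (l : Fin m), Measurable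
    fun y : ({i : Fin n // S.fold n i ≠ l} → Obs 𝒵 d) × 𝒵 => W.psi1 y.2 (S.etaHat n l y.1)
  psi0Hat : ∀ (n : ℕ) (l : Fin m), Measurable
    fun y : ({i : Fin n // S.fold n i ≠ l} → Obs 𝒵 d) × 𝒵 => W.psi0 y.2 (S.etaHat n l y.1)
  gHat : ∀ n : ℕ, Measurable fun y : (Fin n → Obs 𝒵 d) × Vec d => S.gHat n y.1 y.2

/-- The weights `ψ⁺, ψ⁻` are nonnegative and have (uniformly) finite means at the true nuisance
function, and `E[ψ⁺(Z, η₀) | X] ≠ E[ψ⁻(Z, η₀) | X]` almost surely. -/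
structure WeightConditions (W : Weights 𝒵 d r) (H : Set (Vec d → Vec r))
    (P : ℕ → Measure (Obs 𝒵 d)) (η₀ : ℕ → Vec d → Vec r) : Prop where
  psiPlus_nonneg : ∀ η ∈ H, ∀ z, 0 ≤ W.psiPlus z η
  psiMinus_nonneg : ∀ η ∈ H, ∀ z, 0 ≤ W.psiMinus z η
  finite_mean : ∃ M : ℝ, ∀ n,
    ∫⁻ o, ENNReal.ofReal (W.psiPlus o.1 (η₀ n) + W.psiMinus o.1 (η₀ n)) ∂(P n)
      ≤ ENNReal.ofReal M
  ne : ∀ n, ∀ᵐ o ∂(P n), condMean (P n) (fun z => W.psiPlus z (η₀ n)) o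
    - condMean (P n) (fun z => W.psiMinus z (η₀ n)) o ≠ 0

/-- The surrogate loss function is twice continuously differentiable and strictly convex with
negative derivative at zero. -/
structure SurrogateConditions (φ : ℝ → ℝ) : Prop where
  contDiff : ContDiff ℝ 2 φ
  strictConvex : StrictConvexOn ℝ Set.univ φ
  deriv_neg : deriv φ 0 < 0

/-- `g_k` is a best uniform approximation of `g_*` in the sieve space, with error `o(n^{-1/2})`,
and the policy estimator is at uniform distance `o_p(n^{-1/4})` of it. -/
structure PolicyRate (p : ℕ → Vec d → ℝ) (k : ℕ → ℕ) (P : ℕ → Measure (Obs 𝒵 d))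
    (gstar gk : ℕ → Vec d → ℝ) (S : Estimators 𝒵 d r m) : Prop where
  mem : ∀ n, gk n ∈ sieve p (k n)
  best : ∀ n, ∀ g ∈ sieve p (k n), supDist (P n) (gstar n) (gk n) ≤ supDist (P n) (gstar n) g
  rate : IsLittleOp P (fun n w => supDist (P n) (S.gHat n w) (gk n))
    (fun n => (n : ℝ) ^ (-(1 / 4) : ℝ))
  bias : Tendsto (fun n : ℕ => ENNReal.ofReal √(n : ℝ) * supDist (P n) (gstar n) (gk n))
    atTop (𝓝 0)

/-- Margin condition: `U = E[ψ₁(Z, η₀) | X] - E[ψ₀(Z, η₀) | X]` has a continuous density on a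
neighbourhood `[-δ, δ]` of zero (with `δ` and a bound of the density uniform in `n`). -/
def MarginCondition (W : Weights 𝒵 d r) (P : ℕ → Measure (Obs 𝒵 d))
    (η₀ : ℕ → Vec d → Vec r) : Prop :=
  ∃ δ C : ℝ, 0 < δ ∧ ∀ n, ∃ f : ℝ → ℝ, ContinuousOn f (Set.Icc (-δ) δ) ∧
    (∀ u ∈ Set.Icc (-δ) δ, 0 ≤ f u ∧ f u ≤ C) ∧
    ∀ A : Set ℝ, MeasurableSet A → A ⊆ Set.Icc (-δ) δ →
      P n {o | condMean (P n) (fun z => W.psi1 z (η₀ n)) o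
        - condMean (P n) (fun z => W.psi0 z (η₀ n)) o ∈ A} = ∫⁻ u in A, ENNReal.ofReal (f u)

/-- Nuisance estimation: the `L²` rate `o_p(n^{-1/4})`, and shrinking neighbourhoods `𝒯_n` of
`η₀` that contain the estimates with probability tending to one and on which the estimation
errors of the weights are negligible in mean and in mean square. -/
structure NuisanceRate (W : Weights 𝒵 d r) (H : Set (Vec d → Vec r))
    (P : ℕ → Measure (Obs 𝒵 d)) (η₀ : ℕ → Vec d → Vec r) (gk : ℕ → Vec d → ℝ)
    (S : Estimators 𝒵 d r m) (T : ℕ → Set (Vec d → Vec r)) : Prop where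
  mem : ∀ n, η₀ n ∈ H
  rate : ∀ l, IsLittleOp P (fun n w => l2Dist (P n) (S.eta n l w) (η₀ n))
    (fun n => (n : ℝ) ^ (-(1 / 4) : ℝ))
  subset : ∀ n, T n ⊆ H
  mem_nhds : ∀ n, η₀ n ∈ T n
  shrinking : Tendsto (fun n => ⨆ η ∈ T n, l2Dist (P n) η (η₀ n)) atTop (𝓝 0)
  est_mem : ∀ l, Tendsto (fun n => sampleLaw (P n) n {w | S.eta n l w ∉ T n}) atTop (𝓝 0)
  mean1 : Tendsto (fun n : ℕ => ENNReal.ofReal √(n : ℝ) * ⨆ η ∈ T n, ENNReal.ofReal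
    |∫ o, (W.psi1 o.1 η - W.psi1 o.1 (η₀ n)) * (if -gk n o.2 < 0 then 1 else 0) ∂(P n)|)
    atTop (𝓝 0)
  mean0 : Tendsto (fun n : ℕ => ENNReal.ofReal √(n : ℝ) * ⨆ η ∈ T n, ENNReal.ofReal
    |∫ o, (W.psi0 o.1 η - W.psi0 o.1 (η₀ n)) * (if gk n o.2 < 0 then 1 else 0) ∂(P n)|)
    atTop (𝓝 0)
  meanSq1 : Tendsto (fun n : ℕ => ENNReal.ofReal √(n : ℝ) * ⨆ η ∈ T n, eLpNorm
    (fun o => (W.psi1 o.1 η - W.psi1 o.1 (η₀ n)) * (if -gk n o.2 < 0 then 1 else 0)) 2 (P n))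
    atTop (𝓝 0)
  meanSq0 : Tendsto (fun n : ℕ => ENNReal.ofReal √(n : ℝ) * ⨆ η ∈ T n, eLpNorm
    (fun o => (W.psi0 o.1 η - W.psi0 o.1 (η₀ n)) * (if gk n o.2 < 0 then 1 else 0)) 2 (P n))
    atTop (𝓝 0)

/-- Boundedness: moments of `ψ₁, ψ₀` of an order `q > 4` are bounded uniformly in the nuisance
function, and the conditional means of `ψ₁, ψ₀` given `X` are bounded. -/
structure BoundednessConditions (W : Weights 𝒵 d r) (H : Set (Vec d → Vec r))
    (P : ℕ → Measure (Obs 𝒵 d)) (η₀ : ℕ → Vec d → Vec r) : Prop where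
  moments : ∃ q M : ℝ, 4 < q ∧ ∀ n, ∀ η ∈ H,
    ∫⁻ o, ENNReal.ofReal (|W.psi1 o.1 η| ^ q) ∂(P n) ≤ ENNReal.ofReal M ∧
    ∫⁻ o, ENNReal.ofReal (|W.psi0 o.1 η| ^ q) ∂(P n) ≤ ENNReal.ofReal M
  condMeans : ∃ M : ℝ, ∀ n, ∀ᵐ o ∂(P n),
    |condMean (P n) (fun z => W.psi1 z (η₀ n)) o| ≤ M ∧
    |condMean (P n) (fun z => W.psi0 z (η₀ n)) o| ≤ M

end PolicyValue

end
open PolicyValue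

namespace PolicyValue

/-! ### Gaussian integrals -/

/-! With the data held fixed, the bootstrap statistic is a linear form in independent standard
Gaussians, so its conditional law is exactly Gaussian, centred, with variance the empirical second
moment of the estimated scores (`integral_bootStat`). Since the integral of a bounded continuous
function against `N(0, v)` is continuous in `v`, everything reduces to showing that this second
moment minus `σ_v²` tends to zero in probability (`tendsto_measure_scoreHat_variance`). Integrating
the bounded conditional discrepancy over the data then gives the unconditional statement.

Consistency of the variance needs no empirical process argument. If `ĝ` and `g_*` are both within
`e` of `g_k`, all three have the same strict sign wherever `|g_*| > 3e`. Hence the squared error of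
each estimated gain is at most `errorBound`: the weight errors on the two sides of `g_k`, plus a
crude bound on the event `|g_*| ≤ 3e`. This bound no longer involves `ĝ`, which is fitted on the
full sample. It depends only on the observation and on a nuisance estimate computed outside its
fold, so conditioning on the other folds and Markov's inequality apply
(`measure_crossfit_average_le`). Fourth moments and Cauchy-Schwarz make the crude part small once
`P(|g_*| ≤ 3e)` tends to zero.

That probability is controlled by the optimality of `g_*` (`IsRegularSurrogate.measure_abs_le`).
Where `|g_*| ≤ ε` but the contrast `U` exceeds `t` in absolute value, shifting `g_*` by `ε` in the
direction of `U` would lower the surrogate risk by about `ε |φ'(0)| |U|`, up to the oscillation of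
`φ'` near zero; such points are therefore rare. The margin condition bounds `P(|U| ≤ t)`. The same
comparison, with competitor zero, shows that `g_*` and `U` never have opposite signs. Hence `V(g_*)
= V₀`, the true score is centred, and Chebyshev's inequality gives laws of large numbers for the
score and its square. -/

lemma map_multiplierLaw_sum (n : ℕ) (c : Fin n → ℝ) :
    (multiplierLaw n).map (fun δ => ∑ i, c i * δ i)
      = gaussianReal 0 (∑ i, c i ^ 2).toNNReal := by
  have hlaw : ∀ i : Fin n, (multiplierLaw n).map (fun δ => c i * δ i)
      = gaussianReal 0 (NNReal.mk (c i ^ 2) (sq_nonneg _) * 1) := fun i => by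
    have h := (measurePreserving_eval (fun _ : Fin n => gaussianReal 0 1) i).map_eq
    have h2 := Measure.map_map (μ := multiplierLaw n) (f := fun δ : Fin n → ℝ => δ i)
      (g := fun x => c i * x) (by fun_prop) (by fun_prop)
    have h3 : (multiplierLaw n).map (fun δ : Fin n → ℝ => δ i) = gaussianReal 0 1 := h
    rw [h3, gaussianReal_map_const_mul, mul_zero] at h2
    exact h2.symm
  have hg : ∀ i : Fin n, HasGaussianLaw (fun δ : Fin n → ℝ => c i * δ i) (multiplierLaw n) :=
    fun i => ⟨by rw [hlaw]; infer_instance⟩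
  have hind : iIndepFun (fun (i : Fin n) (δ : Fin n → ℝ) => c i * δ i) (multiplierLaw n) :=
    iIndepFun_pi (X := fun i (x : ℝ) => c i * x) fun i => by fun_prop
  have hsum := hind.hasGaussianLaw_fun_sum hg
  rw [hsum.map_eq_gaussianReal]
  have hmeas : ∀ i : Fin n, AEMeasurable (fun δ : Fin n → ℝ => c i * δ i) (multiplierLaw n) :=
    fun i => by
    have : Measurable fun δ : Fin n → ℝ => c i * δ i := by fun_prop
    exact this.aemeasurable
  have hm : ∀ i : Fin n, ∫ δ, c i * δ i ∂(multiplierLaw n) = 0 := fun i => by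
    have := integral_map (μ := multiplierLaw n) (φ := fun δ : Fin n → ℝ => c i * δ i)
      (f := fun x => x) (hmeas i) (by fun_prop)
    rw [← this, hlaw, integral_id_gaussianReal]
  have hv : ∀ i : Fin n, Var[fun δ : Fin n → ℝ => c i * δ i; multiplierLaw n] = c i ^ 2 :=
    fun i => by
    rw [← variance_id_map (hmeas i), hlaw, variance_id_gaussianReal]
    simp
  congr 1
  · rw [integral_finsetSum _ fun i _ => (hg i).integrable]
    simp [hm]
  · congr 1
    have := IndepFun.variance_sum (μ := multiplierLaw n) (s := Finset.univ)
      (X := fun (i : Fin n) (δ : Fin n → ℝ) => c i * δ i)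
      (fun i _ => (hg i).memLp_two) (fun i _ j _ hij => hind.indepFun hij)
    simp only [hv] at this
    rw [← this]
    congr 1
    ext δ
    simp

/-- No sign condition on `v` is needed: for negative `v` both `√v` and `v.toNNReal` are zero. -/
lemma integral_gaussianReal_toNNReal (f : ℝ →ᵇ ℝ) (v : ℝ) :
    ∫ t, f t ∂(gaussianReal 0 v.toNNReal) = ∫ x, f (√v * x) ∂(gaussianReal 0 1) := by
  have h := gaussianReal_map_const_mul (μ := 0) (v := 1) (√v)
  have h2 : (NNReal.mk (√v ^ 2) (sq_nonneg _) * 1 : ℝ≥0) = v.toNNReal := by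
    ext
    rcases le_total 0 v with hv | hv
    · simp [Real.sq_sqrt hv, hv]
    · simp [Real.sqrt_eq_zero_of_nonpos hv, hv]
  rw [mul_zero] at h
  rw [← h2]
  rw [← h]
  rw [integral_map (by fun_prop) (by fun_prop)]

/-- After rescaling, `v` sits in the integrand and no longer in the measure, so dominated
convergence applies. -/
lemma continuous_integral_gaussianReal (f : ℝ →ᵇ ℝ) :
    Continuous fun v : ℝ => ∫ t, f t ∂(gaussianReal 0 v.toNNReal) := by
  simp_rw [integral_gaussianReal_toNNReal]
  refine continuous_of_dominated (bound := fun _ => ‖f‖) (fun v => ?_) (fun v => ?_) ?_ ?_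
  · exact (f.continuous.comp (by fun_prop)).aestronglyMeasurable
  · exact Eventually.of_forall fun x => f.norm_coe_le_norm _
  · exact integrable_const _
  · exact Eventually.of_forall fun x => by fun_prop

/-! ### Averages over an i.i.d. sample -/

/-- A weak law for triangular arrays: both the law and the function change with `n`. Chebyshev's
inequality with the uniform bound `K` gives the explicit rate `K / (n ε²)`. -/
lemma tendsto_measure_average_sub_integral {Y : Type*} [MeasurableSpace Y] (P : ℕ → Measure Y)
    [∀ n, IsProbabilityMeasure (P n)] (F : ℕ → Y → ℝ) (hF : ∀ n, MemLp (F n) 2 (P n)) (K : ℝ)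
    (hK : ∀ n, ∫ y, F n y ^ 2 ∂(P n) ≤ K) {ε : ℝ} (hε : 0 < ε) :
    Tendsto (fun n : ℕ => (Measure.pi fun _ : Fin n => P n)
      {w | ε ≤ |1 / (n : ℝ) * ∑ i, F n (w i) - ∫ y, F n y ∂(P n)|}) atTop (𝓝 0) := by
  have hlim : Tendsto (fun n : ℕ => ENNReal.ofReal (K / ε ^ 2 / n)) atTop (𝓝 0) := by
    rw [← ENNReal.ofReal_zero]
    exact ENNReal.tendsto_ofReal (tendsto_const_div_atTop_nhds_zero_nat _)
  refine tendsto_of_tendsto_of_tendsto_of_le_of_le' tendsto_const_nhds hlim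
    (Eventually.of_forall fun _ => zero_le) ?_
  filter_upwards [eventually_gt_atTop 0] with n hn
  have hn' : (0 : ℝ) < n := by exact_mod_cast hn
  set μ := Measure.pi fun _ : Fin n => P n with hμ
  have hmem : ∀ i : Fin n, MemLp (fun w : Fin n → Y => F n (w i)) 2 μ := fun i =>
    (hF n).comp_measurePreserving (measurePreserving_eval (fun _ : Fin n => P n) i)
  have hint : ∀ i : Fin n, ∫ w : Fin n → Y, F n (w i) ∂μ = ∫ y, F n y ∂(P n) := fun i => by
    have h := (measurePreserving_eval (fun _ : Fin n => P n) i).map_eq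
    have hae : AEStronglyMeasurable (F n)
        (Measure.map (Function.eval i) (Measure.pi fun _ : Fin n => P n)) := by
      rw [h]; exact (hF n).aestronglyMeasurable
    have hev : Measurable (Function.eval i : (Fin n → Y) → Y) := measurable_pi_apply i
    have h2 := integral_map hev.aemeasurable hae
    rw [h] at h2
    exact h2.symm
  set A : (Fin n → Y) → ℝ := fun w => 1 / (n : ℝ) * ∑ i, F n (w i) with hA
  have hAmem : MemLp A 2 μ := (memLp_finsetSum Finset.univ fun i _ => hmem i).const_mul _
  have hAint : ∫ w, A w ∂μ = ∫ y, F n y ∂(P n) := by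
    rw [hA, integral_const_mul, integral_finsetSum _ fun i _ => (hmem i).integrable one_le_two]
    simp [hint]
    field_simp
  have hvar : Var[A; μ] ≤ K / n := by
    have h1 := variance_sum_pi (μ := fun _ : Fin n => P n) (X := fun _ => F n) fun _ => hF n
    have h2 : (∑ i : Fin n, fun w : Fin n → Y => F n (w i)) = fun w => ∑ i, F n (w i) := by
      ext w; simp
    rw [h2] at h1
    rw [hA, variance_const_mul, h1]
    have h3 : Var[F n; P n] ≤ K :=
      (variance_le_expectation_sq (hF n).aestronglyMeasurable).trans (hK n)
    simp only [Finset.sum_const, Finset.card_univ, Fintype.card_fin, nsmul_eq_mul]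
    have : (1 / (n : ℝ)) ^ 2 * (n * Var[F n; P n]) = Var[F n; P n] / n := by field_simp
    rw [this]
    gcongr
  have h := meas_ge_le_variance_div_sq hAmem hε
  rw [hAint] at h
  refine h.trans (ENNReal.ofReal_le_ofReal ?_)
  rw [div_div, mul_comm, ← div_div]
  gcongr

/-- Leaving out a block of a product sample, and one coordinate of that block. -/
lemma measurePreserving_restrict_eval {Y : Type*} [MeasurableSpace Y] (P : Measure Y)
    [IsProbabilityMeasure P] {ι : Type*} [Fintype ι] (q : ι → Prop) [DecidablePred q] (i : ι)
    (hi : ¬ q i) :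
    MeasurePreserving (fun w : ι → Y => ((fun j : {j // q j} => w j), w i))
      (Measure.pi fun _ : ι => P) ((Measure.pi fun _ : {j // q j} => P).prod P) := by
  have h1 := measurePreserving_piEquivPiSubtypeProd (fun _ : ι => P) q
  have h2 := measurePreserving_eval (fun _ : {j // ¬ q j} => P) ⟨i, hi⟩
  have h3 := (MeasurePreserving.id (Measure.pi fun _ : {j // q j} => P)).prod h2
  exact h3.comp h1

/-- Markov's inequality for the average of `F_i(w_{-i}, w_i)`, where `w_{-i}` leaves out a block
containing `i`, when the conditional means given `w_{-i}` are small with high probability. -/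
lemma measure_crossfit_average_le {Y : Type*} [MeasurableSpace Y] (P : Measure Y)
    [IsProbabilityMeasure P] {n m : ℕ} (hn : n ≠ 0) (fold : Fin n → Fin m)
    (F : ∀ l : Fin m, ({j : Fin n // fold j ≠ l} → Y) × Y → ℝ≥0∞) (hF : ∀ l, Measurable (F l))
    (r t : ℝ≥0∞) (ht : t ≠ 0) (ht' : t ≠ ∞) :
    (Measure.pi fun _ : Fin n => P)
      {w : Fin n → Y | t * n ≤ ∑ i, F (fold i) ((fun j => w j.1), w i)} ≤
      (∑ l, (Measure.pi fun _ : Fin n => P)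
        {w : Fin n → Y | r < ∫⁻ y, F l ((fun j => w j.1), y) ∂P}) + r / t := by
  classical
  set μ := Measure.pi fun _ : Fin n => P with hμ
  have hΦ : ∀ l, Measurable fun u => ∫⁻ y, F l (u, y) ∂P := fun l => (hF l).lintegral_prod_right'
  -- Truncation: `F'` vanishes when the conditional mean given the left-out sample exceeds `r`, so
  -- its own conditional mean is at most `r` everywhere. It equals `F` outside the exceptional
  -- events counted by the first sum.
  set F' : ∀ l : Fin m, ({j : Fin n // fold j ≠ l} → Y) × Y → ℝ≥0∞ := fun l x =>
    {u | ∫⁻ y, F l (u, y) ∂P ≤ r}.indicator (fun _ => F l x) x.1 with hF'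
  have hset : ∀ l, MeasurableSet {u | ∫⁻ y, F l (u, y) ∂P ≤ r} := fun l =>
    measurableSet_le (hΦ l) measurable_const
  have hF'm : ∀ l, Measurable (F' l) := fun l =>
    (hF l).indicator ((hset l).preimage measurable_fst)
  have hmean : ∀ i, ∫⁻ w, F' (fold i) ((fun j => w j.1), w i) ∂μ ≤ r := fun i => by
    have hmp := measurePreserving_restrict_eval P (fun j => fold j ≠ fold i) i (by simp)
    have h1 := hmp.lintegral_comp (hF'm (fold i))
    rw [h1, lintegral_prod _ (hF'm _).aemeasurable]
    refine (lintegral_mono (g := fun _ => r) fun u => ?_).trans (by simp)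
    by_cases hu : ∫⁻ y, F (fold i) (u, y) ∂P ≤ r
    · simp [hF', Set.indicator, hu]
    · simp [hF', Set.indicator, hu]
  have hsub : {w : Fin n → Y | t * n ≤ ∑ i, F (fold i) ((fun j => w j.1), w i)} ⊆
      (⋃ l, {w : Fin n → Y | r < ∫⁻ y, F l ((fun j => w j.1), y) ∂P}) ∪
        {w : Fin n → Y | t * n ≤ ∑ i, F' (fold i) ((fun j => w j.1), w i)} := by
    intro w hw
    by_cases hall : ∀ l, ∫⁻ y, F l ((fun j => w j.1), y) ∂P ≤ r
    · right
      have : ∀ i, F' (fold i) ((fun j => w j.1), w i) = F (fold i) ((fun j => w j.1), w i) :=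
        fun i => by simp [hF', Set.indicator, hall]
      simpa [this] using hw
    · left
      push Not at hall
      simpa using hall
  refine (measure_mono hsub).trans ((measure_union_le _ _).trans ?_)
  refine add_le_add ?_ ?_
  · exact (measure_iUnion_le _).trans_eq (tsum_fintype _)
  · have hn0 : (n : ℝ≥0∞) ≠ 0 := by exact_mod_cast hn
    have hm : Measurable fun w : Fin n → Y => ∑ i, F' (fold i) ((fun j => w j.1), w i) := by
      refine Finset.measurable_sum _ fun i _ => (hF'm _).comp ?_
      exact (measurable_pi_lambda _ fun j => measurable_pi_apply _).prodMk (measurable_pi_apply _)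
    refine (meas_ge_le_lintegral_div hm.aemeasurable (by simp [ht, hn0])
      (ENNReal.mul_ne_top ht' (by simp))).trans ?_
    rw [lintegral_finsetSum]
    · calc (∑ i, ∫⁻ w, F' (fold i) ((fun j => w j.1), w i) ∂μ) / (t * n)
          ≤ (∑ _i : Fin n, r) / (t * n) := by gcongr with i; exact hmean i
        _ = r * n / (t * n) := by simp [mul_comm]
        _ = r / t := ENNReal.mul_div_mul_right _ _ hn0 (by simp)
    · intro i _
      exact (hF'm _).comp
        ((measurable_pi_lambda _ fun j => measurable_pi_apply _).prodMk (measurable_pi_apply _))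

variable {𝒵 : Type*} [MeasurableSpace 𝒵] {d r m : ℕ}

/-! ### The surrogate policy -/

lemma ConvexOn.add_deriv_mul_sub_le {φ : ℝ → ℝ} (hφ : ConvexOn ℝ Set.univ φ)
    (hd : Differentiable ℝ φ) (x y : ℝ) : φ x + deriv φ x * (y - x) ≤ φ y := by
  rcases lt_trichotomy x y with h | h | h
  · have := hφ.le_slope_of_hasDerivAt (Set.mem_univ x) (Set.mem_univ y) h (hd x).hasDerivAt
    rw [slope_def_field, le_div_iff₀ (by linarith)] at this
    linarith
  · simp [h]
  · have := hφ.slope_le_of_hasDerivAt (Set.mem_univ y) (Set.mem_univ x) h (hd x).hasDerivAt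
    rw [slope_def_field, div_le_iff₀ (by linarith)] at this
    linarith

/-- The difference of two regression functions as a function of the covariate. -/
lemma exists_regression_sub (P : Measure (Obs 𝒵 d)) [IsProbabilityMeasure P] {f₁ f₀ : 𝒵 → ℝ}
    (h₁ : Integrable (fun o : Obs 𝒵 d => f₁ o.1) P)
    (h₀ : Integrable (fun o : Obs 𝒵 d => f₀ o.1) P) :
    ∃ u : Vec d → ℝ, Measurable u ∧ (∀ o, condMean P f₁ o - condMean P f₀ o = u o.2) ∧
      Integrable (fun o : Obs 𝒵 d => u o.2) P ∧
      ∀ (k : Vec d → ℝ) (C : ℝ), Measurable k → (∀ x, |k x| ≤ C) →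
        ∫ o, k o.2 * (f₁ o.1 - f₀ o.1) ∂P = ∫ o, k o.2 * u o.2 ∂P := by
  set mX : MeasurableSpace (Obs 𝒵 d) :=
    MeasurableSpace.comap (Prod.snd : Obs 𝒵 d → Vec d) inferInstance with hmX
  have hle : mX ≤ Prod.instMeasurableSpace := measurable_snd.comap_le
  have hsm : StronglyMeasurable[mX] fun o => condMean P f₁ o - condMean P f₀ o :=
    (stronglyMeasurable_condExp (m := mX)).sub stronglyMeasurable_condExp
  -- Doob-Dynkin: a function measurable with respect to the covariate factors through it, and the
  -- identity holds at every point.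
  obtain ⟨u, hu, heq⟩ := (hsm.measurable).exists_eq_measurable_comp
  have hint : Integrable (fun o : Obs 𝒵 d => u o.2) P := by
    have : (fun o : Obs 𝒵 d => u o.2) = fun o => condMean P f₁ o - condMean P f₀ o := heq.symm
    rw [this]
    exact integrable_condExp.sub integrable_condExp
  refine ⟨u, hu, fun o => congrFun heq o, hint, fun k C hk hkC => ?_⟩
  have hkX : StronglyMeasurable[mX] fun o : Obs 𝒵 d => k o.2 :=
    (hk.comp (comap_measurable (Prod.snd : Obs 𝒵 d → Vec d))).stronglyMeasurable
  have hbd : ∀ᵐ o : Obs 𝒵 d ∂P, ‖k o.2‖ ≤ C := Eventually.of_forall fun o => hkC o.2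
  have hpull : ∀ f : 𝒵 → ℝ, Integrable (fun o : Obs 𝒵 d => f o.1) P →
      Integrable (fun o : Obs 𝒵 d => k o.2 * f o.1) P ∧
      Integrable (fun o : Obs 𝒵 d => k o.2 * condMean P f o) P ∧
      ∫ o, k o.2 * f o.1 ∂P = ∫ o, k o.2 * condMean P f o ∂P := fun f hf => by
    have hi : Integrable (fun o : Obs 𝒵 d => k o.2 * f o.1) P :=
      hf.bdd_mul (hk.comp measurable_snd).aestronglyMeasurable hbd
    refine ⟨hi, integrable_condExp.bdd_mul (hk.comp measurable_snd).aestronglyMeasurable hbd, ?_⟩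
    have h := condExp_mul_of_stronglyMeasurable_left (μ := P) hkX hi hf
    rw [← integral_condExp hle]
    exact integral_congr_ae h
  obtain ⟨a1, b1, c1⟩ := hpull f₁ h₁
  obtain ⟨a0, b0, c0⟩ := hpull f₀ h₀
  have e1 : (fun o : Obs 𝒵 d => k o.2 * u o.2)
      = fun o => k o.2 * condMean P f₁ o - k o.2 * condMean P f₀ o := by
    ext o
    rw [← mul_sub]
    congr 1
    exact (congrFun heq o).symm
  simp_rw [e1, mul_sub]
  rw [integral_sub a1 a0, integral_sub b1 b0, c1, c0]

/-- Moving the surrogate policy `g` to `h` on a set of covariates cannot decrease the risk; by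
convexity this bounds the first order term at `h`. -/
lemma setIntegral_firstOrder_nonpos (W : Weights 𝒵 d r) {φ : ℝ → ℝ}
    (hφ : ConvexOn ℝ Set.univ φ) (hd : ContDiff ℝ 1 φ) (P : Measure (Obs 𝒵 d))
    (η : Vec d → Vec r) (g : Vec d → ℝ)
    (hg : IsSurrogatePolicy W φ P η g)
    (hp : ∀ z, 0 ≤ W.psiPlus z η) (hm : ∀ z, 0 ≤ W.psiMinus z η)
    (hpi : Integrable (fun o : Obs 𝒵 d => W.psiPlus o.1 η) P)
    (hmi : Integrable (fun o : Obs 𝒵 d => W.psiMinus o.1 η) P)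
    {B : Set (Vec d)} (hB : MeasurableSet B) {h : Vec d → ℝ} (hh : Measurable h) {K : ℝ}
    (hgK : ∀ x ∈ B, |g x| ≤ K) (hhK : ∀ x ∈ B, |h x| ≤ K) :
    ∫ o in Prod.snd ⁻¹' B, (h o.2 - g o.2) *
      (W.psiPlus o.1 η * deriv φ (-h o.2) - W.psiMinus o.1 η * deriv φ (h o.2)) ∂P ≤ 0 := by
  classical
  set A : Set (Obs 𝒵 d) := Prod.snd ⁻¹' B with hAdef
  have hA : MeasurableSet A := measurable_snd hB
  have hcφ : Continuous φ := hd.continuous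
  have hcφ' : Continuous (deriv φ) := hd.continuous_deriv le_rfl
  have hdiff : Differentiable ℝ φ := hd.differentiable one_ne_zero
  -- The bound `K` serves to make `φ` and `φ'` bounded at `±h` on `B`. The spliced competitor then
  -- has finite risk, as `minimal` demands.
  obtain ⟨C, hC⟩ := (isCompact_Icc (a := -K) (b := K)).exists_bound_of_continuousOn
    hcφ.continuousOn
  obtain ⟨C', hC'⟩ := (isCompact_Icc (a := -K) (b := K)).exists_bound_of_continuousOn
    hcφ'.continuousOn
  have hmem : ∀ x ∈ B, h x ∈ Set.Icc (-K) K ∧ -h x ∈ Set.Icc (-K) K := fun x hx => by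
    have := abs_le.1 (hhK x hx)
    constructor <;> constructor <;> linarith
  have hres : ∀ (ψ : Obs 𝒵 d → ℝ), Integrable ψ P → ∀ (c : Vec d → ℝ) (D : ℝ), Measurable c →
      (∀ x ∈ B, |c x| ≤ D) → IntegrableOn (fun o => ψ o * c o.2) A P := fun ψ hψ c D hc hD =>
    hψ.integrableOn.mul_bdd (hc.comp measurable_snd).aestronglyMeasurable
      ((ae_restrict_iff' hA).2 (Eventually.of_forall fun o ho => hD o.2 ho))
  have hlossh : IntegrableOn (surrogateLoss W φ η h) A P :=
    (hres _ hpi (fun x => φ (-h x)) C (by fun_prop) fun x hx => hC _ (hmem x hx).2).add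
      (hres _ hmi (fun x => φ (h x)) C (by fun_prop) fun x hx => hC _ (hmem x hx).1)
  have hfo : IntegrableOn (fun o : Obs 𝒵 d => (h o.2 - g o.2) *
      (W.psiPlus o.1 η * deriv φ (-h o.2) - W.psiMinus o.1 η * deriv φ (h o.2))) A P := by
    have hgm := hg.measurable
    have hb : ∀ x ∈ B, |h x - g x| ≤ 2 * K := fun x hx => by
      have := abs_sub (h x) (g x)
      linarith [hgK x hx, hhK x hx]
    have e1 := hres _ hpi (fun x => (h x - g x) * deriv φ (-h x)) (2 * K * C')
      (by fun_prop) fun x hx => by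
        rw [abs_mul]
        exact mul_le_mul (hb x hx) (hC' _ (hmem x hx).2) (abs_nonneg _)
          ((abs_nonneg _).trans (hb x hx))
    have e2 := hres _ hmi (fun x => (h x - g x) * deriv φ (h x)) (2 * K * C')
      (by fun_prop) fun x hx => by
        rw [abs_mul]
        exact mul_le_mul (hb x hx) (hC' _ (hmem x hx).1) (abs_nonneg _)
          ((abs_nonneg _).trans (hb x hx))
    refine (e1.sub e2).congr (Eventually.of_forall fun o => ?_)
    simp only [Pi.sub_apply]
    ring
  have hpw : ∀ o : Obs 𝒵 d, surrogateLoss W φ η (B.piecewise h g) o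
      = A.piecewise (surrogateLoss W φ η h) (surrogateLoss W φ η g) o := fun o => by
    by_cases ho : o.2 ∈ B
    · have : o ∈ A := ho
      simp [surrogateLoss, ho, this]
    · have : o ∉ A := ho
      simp [surrogateLoss, ho, this]
  have hpw' : surrogateLoss W φ η (B.piecewise h g)
      = A.piecewise (surrogateLoss W φ η h) (surrogateLoss W φ η g) := funext hpw
  have hint : Integrable (surrogateLoss W φ η (B.piecewise h g)) P := by
    rw [hpw']
    exact Integrable.piecewise hA hlossh hg.integrable.integrableOn
  have hmin := hg.minimal _ (hh.piecewise hB hg.measurable) hint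
  rw [hpw', integral_piecewise hA hlossh hg.integrable.integrableOn,
    ← integral_add_compl hA hg.integrable] at hmin
  -- The tangents are taken at `h` rather than at `g`: convexity bounds the loss at `g` from below
  -- by the tangent at `h`, so optimality constrains derivatives evaluated at the freely chosen `h`.
  have hle : ∫ o in A, (h o.2 - g o.2) *
      (W.psiPlus o.1 η * deriv φ (-h o.2) - W.psiMinus o.1 η * deriv φ (h o.2)) ∂P
      ≤ ∫ o in A, (surrogateLoss W φ η g o - surrogateLoss W φ η h o) ∂P := by
    refine setIntegral_mono_on hfo (hg.integrable.integrableOn.sub hlossh) hA fun o _ => ?_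
    have t1 := mul_le_mul_of_nonneg_left
      (ConvexOn.add_deriv_mul_sub_le hφ hdiff (-h o.2) (-g o.2)) (hp o.1)
    have t2 := mul_le_mul_of_nonneg_left
      (ConvexOn.add_deriv_mul_sub_le hφ hdiff (h o.2) (g o.2)) (hm o.1)
    simp only [surrogateLoss]
    linarith
  rw [integral_sub hg.integrable.integrableOn hlossh] at hle
  linarith

/-- Everything about one data generating process that the surrogate policy analysis uses. -/
structure IsRegularSurrogate (W : Weights 𝒵 d r) (φ : ℝ → ℝ) (P : Measure (Obs 𝒵 d))
    (η : Vec d → Vec r) (g u : Vec d → ℝ) : Prop where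
  convex : ConvexOn ℝ Set.univ φ
  contDiff : ContDiff ℝ 1 φ
  policy : IsSurrogatePolicy W φ P η g
  plus_nonneg : ∀ z, 0 ≤ W.psiPlus z η
  minus_nonneg : ∀ z, 0 ≤ W.psiMinus z η
  plus_integrable : Integrable (fun o : Obs 𝒵 d => W.psiPlus o.1 η) P
  minus_integrable : Integrable (fun o : Obs 𝒵 d => W.psiMinus o.1 η) P
  measurable_u : Measurable u
  integrable_u : Integrable (fun o : Obs 𝒵 d => u o.2) P
  regression : ∀ (k : Vec d → ℝ) (C : ℝ), Measurable k → (∀ x, |k x| ≤ C) →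
    ∫ o, k o.2 * (W.psi1 o.1 η - W.psi0 o.1 η) ∂P = ∫ o, k o.2 * u o.2 ∂P

namespace IsRegularSurrogate

variable {W : Weights 𝒵 d r} {φ : ℝ → ℝ} {P : Measure (Obs 𝒵 d)} {η : Vec d → Vec r}
  {g u : Vec d → ℝ}

lemma setIntegral_regression (R : IsRegularSurrogate W φ P η g u) {B : Set (Vec d)}
    (hB : MeasurableSet B) {k : Vec d → ℝ} (hk : Measurable k) {C : ℝ}
    (hC : ∀ x ∈ B, |k x| ≤ C) :
    ∫ o in Prod.snd ⁻¹' B, k o.2 * (W.psiMinus o.1 η - W.psiPlus o.1 η) ∂P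
      = ∫ o in Prod.snd ⁻¹' B, k o.2 * u o.2 ∂P := by
  -- The maximum with zero covers empty `B`, where `C` may be negative.
  have h := R.regression (B.indicator k) (max C 0) (hk.indicator hB) fun x => by
    by_cases hx : x ∈ B
    · simp [hx, hC x hx]
    · simp [hx]
  have hA : MeasurableSet (Prod.snd ⁻¹' B : Set (Obs 𝒵 d)) := measurable_snd hB
  rw [← integral_indicator hA, ← integral_indicator hA]
  convert h using 2
  · ext o
    by_cases hx : o.2 ∈ B
    · simp [hx, Set.indicator, Weights.psi1, Weights.psi0]
    · simp [hx, Set.indicator]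
  · ext o
    by_cases hx : o.2 ∈ B
    · simp [hx, Set.indicator]
    · simp [hx, Set.indicator]

/-- The competitor is `g + σε` on `B`. It stays in `[-2ε, 2ε]`, where `φ'` is within `ω` of `φ'(0)`.
With both derivatives replaced by `φ'(0)`, the first order term becomes `-φ'(0) σ (ψ⁻ - ψ⁺)`, whose
integral over `B` is that of `-φ'(0) σ u`. The replacement costs at most `ω (ψ⁺ + ψ⁻)`. -/
lemma setIntegral_le_of_small (R : IsRegularSurrogate W φ P η g u) {ε ω σ : ℝ} (hε : 0 < ε)
    (hσ : |σ| = 1) (hω : ∀ t, |t| ≤ 2 * ε → |deriv φ t - deriv φ 0| ≤ ω) {B : Set (Vec d)}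
    (hB : MeasurableSet B) (hgB : ∀ x ∈ B, |g x| ≤ ε) :
    -deriv φ 0 * ∫ o in Prod.snd ⁻¹' B, σ * u o.2 ∂P
      ≤ ω * ∫ o, (W.psiPlus o.1 η + W.psiMinus o.1 η) ∂P := by
  set A : Set (Obs 𝒵 d) := Prod.snd ⁻¹' B with hAdef
  have hA : MeasurableSet A := measurable_snd hB
  have hcφ' : Continuous (deriv φ) := R.contDiff.continuous_deriv le_rfl
  have hω0 : 0 ≤ ω := (abs_nonneg _).trans (hω 0 (by simp [hε.le]))
  have hhB : ∀ x ∈ B, |g x + σ * ε| ≤ 2 * ε := fun x hx => by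
    have := abs_add_le (g x) (σ * ε)
    rw [abs_mul, hσ, abs_of_pos hε] at this
    linarith [hgB x hx]
  have hgm := R.policy.measurable
  have hfo := setIntegral_firstOrder_nonpos W R.convex R.contDiff P η g R.policy R.plus_nonneg
    R.minus_nonneg R.plus_integrable R.minus_integrable hB (h := fun x => g x + σ * ε)
    (by fun_prop) (K := 2 * ε) (fun x hx => (hgB x hx).trans (by linarith)) hhB
  have hfo2 : ∫ o in A, ε * (σ * (W.psiPlus o.1 η * deriv φ (-(g o.2 + σ * ε))
      - W.psiMinus o.1 η * deriv φ (g o.2 + σ * ε))) ∂P ≤ 0 := by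
    convert hfo using 3 with o
    ring
  rw [integral_const_mul] at hfo2
  have hfo3 := nonpos_of_mul_nonpos_right hfo2 hε
  have hbd : ∀ t, |t| ≤ 2 * ε → |deriv φ t| ≤ |deriv φ 0| + ω := fun t ht => by
    have := abs_add_le (deriv φ t - deriv φ 0) (deriv φ 0)
    rw [sub_add_cancel] at this
    linarith [hω t ht]
  have hres : ∀ (ψ : Obs 𝒵 d → ℝ), Integrable ψ P → ∀ (c : Vec d → ℝ) (D : ℝ), Measurable c →
      (∀ x ∈ B, |c x| ≤ D) → IntegrableOn (fun o => ψ o * c o.2) A P := fun ψ hψ c D hc hD =>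
    hψ.integrableOn.mul_bdd (hc.comp measurable_snd).aestronglyMeasurable
      ((ae_restrict_iff' hA).2 (Eventually.of_forall fun o ho => hD o.2 ho))
  have i1 : IntegrableOn (fun o : Obs 𝒵 d => σ * (W.psiPlus o.1 η * deriv φ (-(g o.2 + σ * ε))
      - W.psiMinus o.1 η * deriv φ (g o.2 + σ * ε))) A P := by
    refine Integrable.const_mul (Integrable.sub ?_ ?_) _
    · exact hres _ R.plus_integrable (fun x => deriv φ (-(g x + σ * ε))) _ (by fun_prop)
        fun x hx => hbd _ (by rw [abs_neg]; exact hhB x hx)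
    · exact hres _ R.minus_integrable (fun x => deriv φ (g x + σ * ε)) _ (by fun_prop)
        fun x hx => hbd _ (hhB x hx)
  have i2 : Integrable (fun o : Obs 𝒵 d => W.psiPlus o.1 η + W.psiMinus o.1 η) P :=
    R.plus_integrable.add R.minus_integrable
  have i3 : Integrable (fun o : Obs 𝒵 d => σ * (W.psiMinus o.1 η - W.psiPlus o.1 η)) P :=
    (R.minus_integrable.sub R.plus_integrable).const_mul _
  have hmono : ∫ o in A, (-deriv φ 0 * (σ * (W.psiMinus o.1 η - W.psiPlus o.1 η))
      - ω * (W.psiPlus o.1 η + W.psiMinus o.1 η)) ∂P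
      ≤ ∫ o in A, σ * (W.psiPlus o.1 η * deriv φ (-(g o.2 + σ * ε))
      - W.psiMinus o.1 η * deriv φ (g o.2 + σ * ε)) ∂P := by
    refine setIntegral_mono_on ((i3.const_mul _).integrableOn.sub (i2.const_mul _).integrableOn)
      i1 hA fun o ho => ?_
    have h1 := hω (-(g o.2 + σ * ε)) (by rw [abs_neg]; exact hhB o.2 ho)
    have h2 := hω (g o.2 + σ * ε) (hhB o.2 ho)
    have h3 : |σ * (deriv φ (-(g o.2 + σ * ε)) - deriv φ 0)| ≤ ω := by
      rw [abs_mul, hσ, one_mul]; exact h1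
    have h4 : |σ * (deriv φ (g o.2 + σ * ε) - deriv φ 0)| ≤ ω := by
      rw [abs_mul, hσ, one_mul]; exact h2
    have h5 := mul_le_mul_of_nonneg_left (neg_le_of_abs_le h3) (R.plus_nonneg o.1)
    have h6 := mul_le_mul_of_nonneg_left (le_of_abs_le h4) (R.minus_nonneg o.1)
    linarith
  rw [integral_sub (i3.const_mul _).integrableOn (i2.const_mul _).integrableOn,
    integral_const_mul (-deriv φ 0), integral_const_mul ω] at hmono
  have hreg := R.setIntegral_regression hB (k := fun _ => σ) measurable_const (C := |σ|)
    fun _ _ => le_rfl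
  rw [← hreg]
  have hle : ∫ o in A, (W.psiPlus o.1 η + W.psiMinus o.1 η) ∂P
      ≤ ∫ o, (W.psiPlus o.1 η + W.psiMinus o.1 η) ∂P :=
    setIntegral_le_integral i2
      (Eventually.of_forall fun o => add_nonneg (R.plus_nonneg o.1) (R.minus_nonneg o.1))
  have := mul_le_mul_of_nonneg_left hle hω0
  linarith

/-- The surrogate policy and the regression contrast do not have opposite signs. -/
lemma ae_mul_nonneg (R : IsRegularSurrogate W φ P η g u) (h0 : deriv φ 0 < 0) :
    ∀ᵐ o ∂P, 0 ≤ g o.2 * u o.2 := by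
  have hgm := R.policy.measurable
  have hum := R.measurable_u
  -- The competitor is zero on `B`, so the first order condition reads `φ'(0) ∫_B g u ≤ 0`. Since
  -- `φ'(0) < 0`, the integral of `g u` over `B` is nonnegative although `g u < 0` there, and `B`
  -- must be null. The truncation at `K` supplies the boundedness that the comparison requires.
  have key : ∀ K : ℕ, P (Prod.snd ⁻¹' {x | g x * u x < 0 ∧ |g x| ≤ K}) = 0 := fun K => by
    set B : Set (Vec d) := {x | g x * u x < 0 ∧ |g x| ≤ K} with hBdef
    have hB : MeasurableSet B := by
      rw [hBdef, Set.ofPred_and]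
      exact (measurableSet_lt (by fun_prop) (by fun_prop)).inter (measurableSet_le (by fun_prop) (by fun_prop))
    have hA : MeasurableSet (Prod.snd ⁻¹' B : Set (Obs 𝒵 d)) := measurable_snd hB
    have hfo := setIntegral_firstOrder_nonpos W R.convex R.contDiff P η g R.policy R.plus_nonneg
      R.minus_nonneg R.plus_integrable R.minus_integrable hB (h := fun _ => 0)
      measurable_const (K := K) (fun x hx => hx.2) (fun x _ => by simp)
    have hreg := R.setIntegral_regression hB hgm (C := K) fun x hx => hx.2
    have e : ∫ o in Prod.snd ⁻¹' B, deriv φ 0 * (g o.2 * (W.psiMinus o.1 η - W.psiPlus o.1 η)) ∂P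
        ≤ 0 := by
      convert hfo using 3 with o
      simp only [neg_zero]
      ring
    rw [integral_const_mul, hreg] at e
    have hge : 0 ≤ ∫ o in Prod.snd ⁻¹' B, g o.2 * u o.2 ∂P := by
      by_contra! hlt
      linarith [mul_pos_of_neg_of_neg h0 hlt]
    by_contra hne
    have hint : IntegrableOn (fun o : Obs 𝒵 d => -(g o.2 * u o.2)) (Prod.snd ⁻¹' B) P :=
      (R.integrable_u.integrableOn.bdd_mul (hgm.comp measurable_snd).aestronglyMeasurable
        ((ae_restrict_iff' hA).2 (Eventually.of_forall fun o ho => ho.2))).neg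
    have hpos : 0 < ∫ o in Prod.snd ⁻¹' B, -(g o.2 * u o.2) ∂P := by
      refine (setIntegral_pos_iff_support_of_nonneg_ae ?_ hint).2 ?_
      · refine (ae_restrict_iff' hA).2 (Eventually.of_forall fun o ho => ?_)
        have := ho.1
        simp only [Pi.zero_apply]
        linarith
      · refine lt_of_lt_of_le (pos_iff_ne_zero.2 hne) (measure_mono fun o ho => ⟨?_, ho⟩)
        simp only [Function.mem_support, ne_eq, neg_eq_zero]
        exact ho.1.ne
    rw [integral_neg] at hpos
    linarith
  have hall : ∀ᵐ o ∂P, ∀ K : ℕ, ¬ (g o.2 * u o.2 < 0 ∧ |g o.2| ≤ K) :=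
    ae_all_iff.2 fun K => by
      rw [ae_iff]
      simpa using key K
  filter_upwards [hall] with o ho
  by_contra! hlt
  obtain ⟨K, hK⟩ := exists_nat_ge |g o.2|
  exact ho K ⟨hlt, hK⟩

/-- A surrogate policy close to zero forces a small regression contrast, up to an event whose
probability is controlled by the modulus of continuity of `φ'` at zero. -/
lemma measure_abs_le (R : IsRegularSurrogate W φ P η g u) [IsProbabilityMeasure P]
    (h0 : deriv φ 0 < 0) {ε ω t M : ℝ} (hε : 0 < ε) (ht : 0 < t)
    (hω : ∀ s, |s| ≤ 2 * ε → |deriv φ s - deriv φ 0| ≤ ω)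
    (hM : ∫ o, (W.psiPlus o.1 η + W.psiMinus o.1 η) ∂P ≤ M) :
    P {o | |g o.2| ≤ ε} ≤
      P {o | |u o.2| ≤ t} + 2 * ENNReal.ofReal (ω * M / (t * -deriv φ 0)) := by
  have hgm := R.policy.measurable
  have hum := R.measurable_u
  have hω0 : 0 ≤ ω := (abs_nonneg _).trans (hω 0 (by simp [hε.le]))
  have hφ0 : 0 < -deriv φ 0 := by linarith
  -- The two signs of `u` are treated separately so that the shift `σε` has a constant direction on
  -- the set. Markov's inequality for `σu ≥ t` turns the integral bound into a probability bound.
  have key : ∀ σ : ℝ, |σ| = 1 → P (Prod.snd ⁻¹' {x | |g x| ≤ ε ∧ t ≤ σ * u x})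
      ≤ ENNReal.ofReal (ω * M / (t * -deriv φ 0)) := fun σ hσ => by
    set B : Set (Vec d) := {x | |g x| ≤ ε ∧ t ≤ σ * u x} with hBdef
    have hB : MeasurableSet B := by
      rw [hBdef, Set.ofPred_and]
      exact (measurableSet_le (by fun_prop) (by fun_prop)).inter (measurableSet_le (by fun_prop) (by fun_prop))
    have hA : MeasurableSet (Prod.snd ⁻¹' B : Set (Obs 𝒵 d)) := measurable_snd hB
    have h1 := R.setIntegral_le_of_small hε hσ hω hB fun x hx => hx.1
    have h2 : t * P.real (Prod.snd ⁻¹' B) ≤ ∫ o in Prod.snd ⁻¹' B, σ * u o.2 ∂P := by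
      have : ∫ _ in (Prod.snd ⁻¹' B : Set (Obs 𝒵 d)), t ∂P = t * P.real (Prod.snd ⁻¹' B) := by
        rw [setIntegral_const, smul_eq_mul, mul_comm]
      rw [← this]
      exact setIntegral_mono_on (integrable_const t).integrableOn
        (R.integrable_u.const_mul σ).integrableOn hA fun o ho => ho.2
    rw [← ofReal_measureReal]
    refine ENNReal.ofReal_le_ofReal ?_
    rw [le_div_iff₀ (by positivity)]
    have h3 := mul_le_mul_of_nonneg_left hM hω0
    have h4 := mul_le_mul_of_nonneg_left h2 hφ0.le
    linarith
  have hsub : {o : Obs 𝒵 d | |g o.2| ≤ ε} ⊆ {o | |u o.2| ≤ t} ∪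
      (Prod.snd ⁻¹' {x | |g x| ≤ ε ∧ t ≤ 1 * u x} ∪
        Prod.snd ⁻¹' {x | |g x| ≤ ε ∧ t ≤ (-1) * u x}) := fun o ho => by
    by_cases h : |u o.2| ≤ t
    · exact Or.inl h
    · right
      push Not at h
      rcases lt_abs.1 h with h | h
      · exact Or.inl ⟨ho, by linarith⟩
      · exact Or.inr ⟨ho, by linarith⟩
  refine (measure_mono hsub).trans ((measure_union_le _ _).trans ?_)
  refine add_le_add le_rfl ((measure_union_le _ _).trans ?_)
  rw [two_mul]
  exact add_le_add (key 1 (by simp)) (key (-1) (by simp))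

end IsRegularSurrogate

/-! ### The optimal policy value -/

lemma gain_eq_add {𝒵 : Type*} {d r : ℕ} (W : Weights 𝒵 d r) (η : Vec d → Vec r) (g : Vec d → ℝ) (o : Obs 𝒵 d) :
    gain W η g o = W.psi0 o.1 η
      + (if 0 ≤ g o.2 then 1 else 0) * (W.psi1 o.1 η - W.psi0 o.1 η) := by
  by_cases h : 0 ≤ g o.2
  · simp [gain, h, not_lt.2 h]
  · simp [gain, h, not_le.1 h]

/-- The value of `h` is `E ψ₀ + E[1{h ≥ 0} u]`, which is maximal as soon as `h` has the sign of `u`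
almost everywhere. `ae_mul_nonneg` says this of `g` except where `g = 0`, since there the product
tells nothing about the sign of `u`; hence the hypothesis `hz`. -/
lemma IsRegularSurrogate.optimalValue_eq {W : Weights 𝒵 d r} {φ : ℝ → ℝ}
    {P : Measure (Obs 𝒵 d)} {η : Vec d → Vec r} {g u : Vec d → ℝ}
    (R : IsRegularSurrogate W φ P η g u) (h0 : deriv φ 0 < 0)
    (h1 : Integrable (fun o : Obs 𝒵 d => W.psi1 o.1 η) P)
    (h2 : Integrable (fun o : Obs 𝒵 d => W.psi0 o.1 η) P)
    (hz : P {o | g o.2 = 0} = 0) : optimalValue W P η = value W P η g := by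
  have hform : ∀ h : Vec d → ℝ, Measurable h → value W P η h
      = ∫ o, W.psi0 o.1 η ∂P + ∫ o, (if 0 ≤ h o.2 then 1 else 0) * u o.2 ∂P ∧
      Integrable (fun o : Obs 𝒵 d => (if 0 ≤ h o.2 then 1 else 0) * u o.2) P := fun h hh => by
    have hk : Measurable fun x => if 0 ≤ h x then (1 : ℝ) else 0 :=
      Measurable.ite (measurableSet_le measurable_const hh) measurable_const measurable_const
    have hb : ∀ x, |if 0 ≤ h x then (1 : ℝ) else 0| ≤ 1 := fun x => by split_ifs <;> simp
    have hkm : AEStronglyMeasurable (fun o : Obs 𝒵 d => if 0 ≤ h o.2 then (1 : ℝ) else 0) P :=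
      (hk.comp measurable_snd).aestronglyMeasurable
    have hbm : ∀ᵐ o : Obs 𝒵 d ∂P, ‖if 0 ≤ h o.2 then (1 : ℝ) else 0‖ ≤ 1 :=
      Eventually.of_forall fun o => hb o.2
    refine ⟨?_, R.integrable_u.bdd_mul hkm hbm⟩
    have i3 : Integrable (fun o : Obs 𝒵 d => (if 0 ≤ h o.2 then (1 : ℝ) else 0) *
        (W.psi1 o.1 η - W.psi0 o.1 η)) P := (h1.sub h2).bdd_mul hkm hbm
    rw [← R.regression _ 1 hk hb, ← integral_add h2 i3]
    exact integral_congr_ae (Eventually.of_forall fun o => gain_eq_add W η h o)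
  have hle : ∀ h : {h : Vec d → ℝ // Measurable h}, value W P η h.1 ≤ value W P η g := by
    rintro ⟨h, hh⟩
    obtain ⟨e1, i1⟩ := hform h hh
    obtain ⟨e2, i2⟩ := hform g R.policy.measurable
    rw [e1, e2]
    refine add_le_add le_rfl (integral_mono_ae i1 i2 ?_)
    have hz' : ∀ᵐ o ∂P, g o.2 ≠ 0 := by
      rw [ae_iff]; simpa using hz
    filter_upwards [R.ae_mul_nonneg h0, hz'] with o ho ho'
    rcases lt_or_gt_of_ne ho' with hg | hg
    · have hu : u o.2 ≤ 0 := by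
        by_contra! hu
        linarith [mul_neg_of_neg_of_pos hg hu]
      simp only [not_le.2 hg, if_false, zero_mul]
      split_ifs <;> linarith
    · have hu : 0 ≤ u o.2 := by
        by_contra! hu
        linarith [mul_neg_of_pos_of_neg hg hu]
      simp only [hg.le, if_true, one_mul]
      split_ifs <;> linarith
  have : Nonempty {h : Vec d → ℝ // Measurable h} := ⟨⟨g, R.policy.measurable⟩⟩
  refine le_antisymm (ciSup_le hle) ?_
  exact le_ciSup (f := fun h : {h : Vec d → ℝ // Measurable h} => value W P η h.1)
    ⟨value W P η g, by rintro _ ⟨h, rfl⟩; exact hle h⟩ ⟨g, R.policy.measurable⟩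

/-! ### Moments -/

/-- Fourth moments are all that the variance argument requires: they give square integrability of
squared scores and Cauchy-Schwarz bounds on small events. The absolute value of `M` keeps the
resulting constant nonnegative. -/
lemma lintegral_pow_four_le {Y : Type*} [MeasurableSpace Y] (μ : Measure Y)
    [IsProbabilityMeasure μ] (f : Y → ℝ) {q M : ℝ} (hq : 4 < q)
    (h : ∫⁻ y, ENNReal.ofReal (|f y| ^ q) ∂μ ≤ ENNReal.ofReal M) :
    ∫⁻ y, ENNReal.ofReal (f y ^ 4) ∂μ ≤ ENNReal.ofReal (1 + |M|) := by
  calc ∫⁻ y, ENNReal.ofReal (f y ^ 4) ∂μ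
      ≤ ∫⁻ y, (1 + ENNReal.ofReal (|f y| ^ q)) ∂μ := by
        refine lintegral_mono fun y => ?_
        rw [← ENNReal.ofReal_one, ← ENNReal.ofReal_add zero_le_one (by positivity)]
        refine ENNReal.ofReal_le_ofReal ?_
        have h4 : f y ^ 4 = |f y| ^ (4 : ℝ) := by
          rw [show (4 : ℝ) = ((4 : ℕ) : ℝ) by norm_num, Real.rpow_natCast]
          exact (Even.pow_abs (by decide) _).symm
        rw [h4]
        rcases le_total |f y| 1 with h1 | h1
        · have := Real.rpow_le_one (abs_nonneg (f y)) h1 (by norm_num : (0 : ℝ) ≤ 4)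
          have : 0 ≤ |f y| ^ q := by positivity
          linarith
        · have := Real.rpow_le_rpow_of_exponent_le h1 hq.le
          linarith
    _ = 1 + ∫⁻ y, ENNReal.ofReal (|f y| ^ q) ∂μ := by
        rw [lintegral_add_left measurable_const]; simp
    _ ≤ 1 + ENNReal.ofReal |M| := by
        gcongr
        exact h.trans (ENNReal.ofReal_le_ofReal (le_abs_self M))
    _ = ENNReal.ofReal (1 + |M|) := by
        rw [ENNReal.ofReal_add zero_le_one (abs_nonneg M), ENNReal.ofReal_one]

lemma integrable_pow_four {Y : Type*} [MeasurableSpace Y] {μ : Measure Y} {f : Y → ℝ}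
    (hf : Measurable f) {K : ℝ} (hK : 0 ≤ K)
    (h : ∫⁻ y, ENNReal.ofReal (f y ^ 4) ∂μ ≤ ENNReal.ofReal K) :
    Integrable (fun y => f y ^ 4) μ ∧ ∫ y, f y ^ 4 ∂μ ≤ K := by
  have hnn : 0 ≤ᵐ[μ] fun y => f y ^ 4 := Eventually.of_forall fun y => by positivity
  have hm : Measurable fun y => f y ^ 4 := hf.pow_const 4
  refine ⟨⟨hm.aestronglyMeasurable, ?_⟩, ?_⟩
  · rw [hasFiniteIntegral_iff_ofReal hnn]
    exact h.trans_lt ENNReal.ofReal_lt_top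
  · rw [integral_eq_lintegral_of_nonneg_ae hnn hm.aestronglyMeasurable]
    exact ENNReal.toReal_le_of_le_ofReal hK h

lemma integrable_of_integrable_pow_four {Y : Type*} [MeasurableSpace Y] {μ : Measure Y}
    [IsProbabilityMeasure μ] {f : Y → ℝ} (hf : Measurable f)
    (h : Integrable (fun y => f y ^ 4) μ) : Integrable f μ := by
  refine ((integrable_const 1).add h).mono' hf.aestronglyMeasurable
    (Eventually.of_forall fun y => ?_)
  simp only [Pi.add_apply, Real.norm_eq_abs]
  refine abs_le.2 ⟨?_, ?_⟩ <;>
    nlinarith [sq_nonneg (f y ^ 2 - 1), sq_nonneg (f y - 1), sq_nonneg (f y + 1),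
      sq_nonneg (f y ^ 2)]

lemma integrable_sq_of_integrable_pow_four {Y : Type*} [MeasurableSpace Y] {μ : Measure Y}
    [IsProbabilityMeasure μ] {f : Y → ℝ} (hf : Measurable f) {K : ℝ}
    (h : Integrable (fun y => f y ^ 4) μ) (hK : ∫ y, f y ^ 4 ∂μ ≤ K) :
    Integrable (fun y => f y ^ 2) μ ∧ ∫ y, f y ^ 2 ∂μ ≤ 1 + K := by
  have hdom : Integrable (fun y => 1 + f y ^ 4) μ := (integrable_const 1).add h
  have hle : ∀ y, f y ^ 2 ≤ 1 + f y ^ 4 := fun y => by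
    nlinarith [sq_nonneg (f y ^ 2 - 1), sq_nonneg (f y ^ 2)]
  have hi : Integrable (fun y => f y ^ 2) μ :=
    hdom.mono' (hf.pow_const 2).aestronglyMeasurable (Eventually.of_forall fun y => by
      rw [Real.norm_eq_abs, abs_of_nonneg (sq_nonneg _)]; exact hle y)
  refine ⟨hi, (integral_mono hi hdom hle).trans ?_⟩
  rw [integral_add (integrable_const 1) h]
  simp only [integral_const, probReal_univ, smul_eq_mul, mul_one]
  linarith

/-- Restricted second moments are small on sets of small probability. -/
lemma setLIntegral_sq_le {Y : Type*} [MeasurableSpace Y] {μ : Measure Y} {f : Y → ℝ}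
    (hf : Measurable f) {K : ℝ≥0∞} (h : ∫⁻ y, ENNReal.ofReal (f y ^ 4) ∂μ ≤ K) {A : Set Y}
    (hA : MeasurableSet A) :
    ∫⁻ y in A, ENNReal.ofReal (f y ^ 2) ∂μ ≤ K ^ (1 / 2 : ℝ) * μ A ^ (1 / 2 : ℝ) := by
  have hH := ENNReal.lintegral_mul_le_Lp_mul_Lq μ
    (Real.HolderConjugate.two_two) (f := fun y => ENNReal.ofReal (f y ^ 2))
    (g := A.indicator 1) (by fun_prop) ((measurable_one.indicator hA).aemeasurable)
  rw [← lintegral_indicator hA]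
  calc ∫⁻ y, A.indicator (fun y => ENNReal.ofReal (f y ^ 2)) y ∂μ
      = ∫⁻ y, ENNReal.ofReal (f y ^ 2) * A.indicator 1 y ∂μ := by
        refine lintegral_congr fun y => ?_
        by_cases hy : y ∈ A <;> simp [hy]
    _ ≤ _ := hH
    _ ≤ K ^ (1 / 2 : ℝ) * μ A ^ (1 / 2 : ℝ) := by
        refine mul_le_mul' (ENNReal.rpow_le_rpow (le_trans (le_of_eq ?_) h) (by norm_num))
          (ENNReal.rpow_le_rpow (le_of_eq ?_) (by norm_num))
        · refine lintegral_congr fun y => ?_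
          rw [ENNReal.ofReal_rpow_of_nonneg (sq_nonneg _) (by norm_num)]
          congr 1
          rw [Real.rpow_two]
          ring
        · rw [← lintegral_indicator_one hA]
          refine lintegral_congr fun y => ?_
          by_cases hy : y ∈ A <;> simp [hy]

/-! ### Consequences of the assumptions -/

lemma exists_fourth_moment_bound {W : Weights 𝒵 d r} {H : Set (Vec d → Vec r)}
    {P : ℕ → Measure (Obs 𝒵 d)} [∀ n, IsProbabilityMeasure (P n)] {η₀ : ℕ → Vec d → Vec r}
    (hbdd : BoundednessConditions W H P η₀) :
    ∃ K : ℝ, 0 ≤ K ∧ ∀ n, ∀ η ∈ H,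
      ∫⁻ o, ENNReal.ofReal (W.psi1 o.1 η ^ 4) ∂(P n) ≤ ENNReal.ofReal K ∧
      ∫⁻ o, ENNReal.ofReal (W.psi0 o.1 η ^ 4) ∂(P n) ≤ ENNReal.ofReal K := by
  obtain ⟨q, M, hq, h⟩ := hbdd.moments
  exact ⟨1 + |M|, by positivity, fun n η hη =>
    ⟨lintegral_pow_four_le (P n) _ hq (h n η hη).1, lintegral_pow_four_le (P n) _ hq (h n η hη).2⟩⟩

lemma MeasurabilityConditions.psi1 {W : Weights 𝒵 d r} {H : Set (Vec d → Vec r)}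
    {p : ℕ → Vec d → ℝ} {S : Estimators 𝒵 d r m} (hmeas : MeasurabilityConditions W H p S)
    {η : Vec d → Vec r} (hη : η ∈ H) : Measurable fun z => W.psi1 z η :=
  (hmeas.psiBar η hη).sub (hmeas.psiPlus η hη)

lemma MeasurabilityConditions.psi0 {W : Weights 𝒵 d r} {H : Set (Vec d → Vec r)}
    {p : ℕ → Vec d → ℝ} {S : Estimators 𝒵 d r m} (hmeas : MeasurabilityConditions W H p S)
    {η : Vec d → Vec r} (hη : η ∈ H) : Measurable fun z => W.psi0 z η :=
  (hmeas.psiBar η hη).sub (hmeas.psiMinus η hη)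

section

variable {W : Weights 𝒵 d r} {H : Set (Vec d → Vec r)} {φ : ℝ → ℝ} {p : ℕ → Vec d → ℝ}
  {S : Estimators 𝒵 d r m} {P : ℕ → Measure (Obs 𝒵 d)} [∀ n, IsProbabilityMeasure (P n)]
  {η₀ : ℕ → Vec d → Vec r} {gstar : ℕ → Vec d → ℝ}

lemma integrable_psi_true (hmeas : MeasurabilityConditions W H p S) (hη₀ : ∀ n, η₀ n ∈ H)
    (hbdd : BoundednessConditions W H P η₀) (n : ℕ) :
    Integrable (fun o : Obs 𝒵 d => W.psi1 o.1 (η₀ n)) (P n) ∧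
      Integrable (fun o : Obs 𝒵 d => W.psi0 o.1 (η₀ n)) (P n) := by
  obtain ⟨K, hK, h⟩ := exists_fourth_moment_bound hbdd
  have m1 : Measurable fun o : Obs 𝒵 d => W.psi1 o.1 (η₀ n) :=
    (hmeas.psi1 (hη₀ n)).comp measurable_fst
  have m0 : Measurable fun o : Obs 𝒵 d => W.psi0 o.1 (η₀ n) :=
    (hmeas.psi0 (hη₀ n)).comp measurable_fst
  exact ⟨integrable_of_integrable_pow_four m1 (integrable_pow_four m1 hK (h n _ (hη₀ n)).1).1,
    integrable_of_integrable_pow_four m0 (integrable_pow_four m0 hK (h n _ (hη₀ n)).2).1⟩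

lemma exists_isRegularSurrogate (hmeas : MeasurabilityConditions W H p S)
    (hweights : WeightConditions W H P η₀) (hφ : SurrogateConditions φ)
    (hgstar : ∀ n, IsSurrogatePolicy W φ (P n) (η₀ n) (gstar n)) (hη₀ : ∀ n, η₀ n ∈ H)
    (hbdd : BoundednessConditions W H P η₀) (n : ℕ) :
    ∃ u, IsRegularSurrogate W φ (P n) (η₀ n) (gstar n) u ∧
      ∀ o, condMean (P n) (fun z => W.psi1 z (η₀ n)) o
        - condMean (P n) (fun z => W.psi0 z (η₀ n)) o = u o.2 := by
  obtain ⟨i1, i0⟩ := integrable_psi_true hmeas hη₀ hbdd n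
  obtain ⟨u, hu, heq, hui, hreg⟩ := exists_regression_sub (P n) (f₁ := fun z => W.psi1 z (η₀ n))
    (f₀ := fun z => W.psi0 z (η₀ n)) i1 i0
  obtain ⟨M, hM⟩ := hweights.finite_mean
  have hp := hweights.psiPlus_nonneg _ (hη₀ n)
  have hm := hweights.psiMinus_nonneg _ (hη₀ n)
  have mp : Measurable fun o : Obs 𝒵 d => W.psiPlus o.1 (η₀ n) :=
    (hmeas.psiPlus _ (hη₀ n)).comp measurable_fst
  have mm : Measurable fun o : Obs 𝒵 d => W.psiMinus o.1 (η₀ n) :=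
    (hmeas.psiMinus _ (hη₀ n)).comp measurable_fst
  have hsum : Integrable (fun o : Obs 𝒵 d => W.psiPlus o.1 (η₀ n) + W.psiMinus o.1 (η₀ n))
      (P n) := by
    refine ⟨(mp.add mm).aestronglyMeasurable, ?_⟩
    rw [hasFiniteIntegral_iff_ofReal
      (Eventually.of_forall fun o : Obs 𝒵 d => add_nonneg (hp o.1) (hm o.1))]
    exact (hM n).trans_lt ENNReal.ofReal_lt_top
  refine ⟨u, ⟨hφ.strictConvex.convexOn, hφ.contDiff.of_le (by norm_num), hgstar n, hp, hm, ?_, ?_,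
    hu, hui, hreg⟩, heq⟩
  · refine hsum.mono' mp.aestronglyMeasurable (Eventually.of_forall fun o => ?_)
    simp only [Real.norm_eq_abs, abs_of_nonneg (hp o.1)]
    linarith [hm o.1]
  · refine hsum.mono' mm.aestronglyMeasurable (Eventually.of_forall fun o => ?_)
    simp only [Real.norm_eq_abs, abs_of_nonneg (hm o.1)]
    linarith [hp o.1]

/-- The surrogate policy is rarely close to zero, uniformly along the sequence. -/
lemma exists_measure_abs_gstar_le (hmeas : MeasurabilityConditions W H p S)
    (hweights : WeightConditions W H P η₀) (hφ : SurrogateConditions φ)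
    (hgstar : ∀ n, IsSurrogatePolicy W φ (P n) (η₀ n) (gstar n)) (hη₀ : ∀ n, η₀ n ∈ H)
    (hbdd : BoundednessConditions W H P η₀) (hmargin : MarginCondition W P η₀)
    {ρ : ℝ} (hρ : 0 < ρ) :
    ∃ ε : ℝ, 0 < ε ∧ ∀ n, P n {o | |gstar n o.2| ≤ ε} ≤ ENNReal.ofReal ρ := by
  obtain ⟨δ, C, hδ, hC⟩ := hmargin
  obtain ⟨M, hM⟩ := hweights.finite_mean
  have hφ0 : 0 < -deriv φ 0 := by linarith [hφ.deriv_neg]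
  -- Half of `ρ` is spent on `P(|U| ≤ t) ≤ 2t|C|`, which fixes `t`. The other half is spent on the
  -- term from the modulus of `φ'`, which fixes `ω` below. Both choices depend only on constants
  -- uniform in `n`.
  set t : ℝ := min δ (ρ / (4 * (|C| + 1))) with ht
  have htpos : 0 < t := lt_min hδ (by positivity)
  have htδ : t ≤ δ := min_le_left _ _
  have htρ : 2 * t * |C| ≤ ρ / 2 := by
    have h1 : t ≤ ρ / (4 * (|C| + 1)) := min_le_right _ _
    rw [le_div_iff₀ (by positivity)] at h1
    nlinarith [abs_nonneg C]
  set ω : ℝ := ρ * (t * -deriv φ 0) / (4 * (|M| + 1)) with hω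
  have hωpos : 0 < ω := by positivity
  have hcont : Continuous (deriv φ) :=
    (hφ.contDiff.of_le (by norm_num : (1 : WithTop ℕ∞) ≤ 2)).continuous_deriv le_rfl
  obtain ⟨κ, hκ, hκω⟩ := Metric.continuousAt_iff.1 (hcont.continuousAt (x := (0 : ℝ))) ω hωpos
  -- With this radius `2ε = κ / 2 < κ`, as the strict continuity bound requires.
  refine ⟨κ / 4, by positivity, fun n => ?_⟩
  obtain ⟨u, R, hu⟩ := exists_isRegularSurrogate hmeas hweights hφ hgstar hη₀ hbdd n
  have hMn : ∫ o, (W.psiPlus o.1 (η₀ n) + W.psiMinus o.1 (η₀ n)) ∂(P n) ≤ |M| := by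
    rw [integral_eq_lintegral_of_nonneg_ae (Eventually.of_forall fun o : Obs 𝒵 d =>
      add_nonneg (R.plus_nonneg o.1) (R.minus_nonneg o.1))
      (R.plus_integrable.add R.minus_integrable).aestronglyMeasurable]
    exact ENNReal.toReal_le_of_le_ofReal (abs_nonneg M)
      ((hM n).trans (ENNReal.ofReal_le_ofReal (le_abs_self M)))
  have hmain := R.measure_abs_le hφ.deriv_neg (ε := κ / 4) (ω := ω) (t := t) (M := |M|)
    (by positivity) htpos (fun s hs => by
      have := hκω (x := s) (by rw [Real.dist_eq, sub_zero]; linarith)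
      rw [Real.dist_eq] at this
      exact this.le) hMn
  have hsmall : P n {o | |u o.2| ≤ t} ≤ ENNReal.ofReal (ρ / 2) := by
    obtain ⟨f, -, hf, hdens⟩ := hC n
    have h1 := hdens (Set.Icc (-t) t) measurableSet_Icc
      (Set.Icc_subset_Icc (by linarith) htδ)
    have h2 : {o : Obs 𝒵 d | |u o.2| ≤ t} = {o | condMean (P n) (fun z => W.psi1 z (η₀ n)) o
        - condMean (P n) (fun z => W.psi0 z (η₀ n)) o ∈ Set.Icc (-t) t} := by
      ext o
      simp only [Set.mem_ofPred_eq, hu, Set.mem_Icc, abs_le]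
    rw [h2, h1]
    calc ∫⁻ x in Set.Icc (-t) t, ENNReal.ofReal (f x)
        ≤ ∫⁻ _ in Set.Icc (-t) t, ENNReal.ofReal |C| := by
          refine setLIntegral_mono' measurableSet_Icc fun x hx => ENNReal.ofReal_le_ofReal ?_
          exact (hf x ⟨by linarith [hx.1], hx.2.trans htδ⟩).2.trans (le_abs_self C)
      _ = ENNReal.ofReal (2 * t * |C|) := by
          rw [setLIntegral_const, Real.volume_Icc, ← ENNReal.ofReal_mul (abs_nonneg C)]
          congr 1
          ring
      _ ≤ _ := ENNReal.ofReal_le_ofReal htρ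
  have hrest : 2 * ENNReal.ofReal (ω * |M| / (t * -deriv φ 0)) ≤ ENNReal.ofReal (ρ / 2) := by
    rw [show (2 : ℝ≥0∞) = ENNReal.ofReal 2 by simp, ← ENNReal.ofReal_mul (by norm_num)]
    refine ENNReal.ofReal_le_ofReal ?_
    have e : ω * |M| / (t * -deriv φ 0) = ρ / 4 * (|M| / (|M| + 1)) := by
      rw [hω]
      have := abs_nonneg M
      have := hφ.deriv_neg.ne
      field_simp
    rw [e]
    have : |M| / (|M| + 1) ≤ 1 := (div_le_one (by positivity)).2 (by linarith)
    nlinarith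
  refine hmain.trans ((add_le_add hsmall hrest).trans (le_of_eq ?_))
  rw [← ENNReal.ofReal_add (by positivity) (by positivity)]
  congr 1
  ring

lemma measurable_gain {η : Vec d → Vec r} {g : Vec d → ℝ}
    (h1 : Measurable fun z => W.psi1 z η) (h0 : Measurable fun z => W.psi0 z η)
    (hg : Measurable g) : Measurable (gain W η g) := by
  have a : MeasurableSet {o : Obs 𝒵 d | 0 ≤ g o.2} :=
    measurableSet_le measurable_const (hg.comp measurable_snd)
  have b : MeasurableSet {o : Obs 𝒵 d | g o.2 < 0} :=
    measurableSet_lt (hg.comp measurable_snd) measurable_const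
  exact ((h1.comp measurable_fst).mul (Measurable.ite a measurable_const measurable_const)).add
    ((h0.comp measurable_fst).mul (Measurable.ite b measurable_const measurable_const))

/-- At the true nuisance function and the surrogate policy the score is centered, with a bounded
fourth moment. -/
lemma exists_score_moments (hmeas : MeasurabilityConditions W H p S)
    (hweights : WeightConditions W H P η₀) (hφ : SurrogateConditions φ)
    (hgstar : ∀ n, IsSurrogatePolicy W φ (P n) (η₀ n) (gstar n)) (hη₀ : ∀ n, η₀ n ∈ H)
    (hbdd : BoundednessConditions W H P η₀) (hmargin : MarginCondition W P η₀) :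
    ∃ K : ℝ, 0 ≤ K ∧ ∀ n, Measurable (score W (P n) (η₀ n) (gstar n)) ∧
      Integrable (fun o => score W (P n) (η₀ n) (gstar n) o ^ 4) (P n) ∧
      ∫ o, score W (P n) (η₀ n) (gstar n) o ^ 4 ∂(P n) ≤ K ∧
      ∫ o, score W (P n) (η₀ n) (gstar n) o ∂(P n) = 0 := by
  obtain ⟨K, hK, hKb⟩ := exists_fourth_moment_bound hbdd
  -- From `(G - V)⁴ ≤ 8G⁴ + 8V⁴`, `E G⁴ ≤ 2K` and `|V| ≤ E|G| ≤ 1 + E G⁴`.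
  refine ⟨8 * (2 * K) + 8 * (1 + 2 * K) ^ 4, by positivity, fun n => ?_⟩
  set G := gain W (η₀ n) (gstar n) with hG
  have hGm : Measurable G := measurable_gain (hmeas.psi1 (hη₀ n)) (hmeas.psi0 (hη₀ n))
    (hgstar n).measurable
  obtain ⟨i1, i0⟩ := integrable_psi_true hmeas hη₀ hbdd n
  have m1 : Measurable fun o : Obs 𝒵 d => W.psi1 o.1 (η₀ n) :=
    (hmeas.psi1 (hη₀ n)).comp measurable_fst
  have m0 : Measurable fun o : Obs 𝒵 d => W.psi0 o.1 (η₀ n) :=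
    (hmeas.psi0 (hη₀ n)).comp measurable_fst
  obtain ⟨j1, k1⟩ := integrable_pow_four m1 hK (hKb n _ (hη₀ n)).1
  obtain ⟨j0, k0⟩ := integrable_pow_four m0 hK (hKb n _ (hη₀ n)).2
  have hG4 : ∀ o, G o ^ 4 ≤ W.psi1 o.1 (η₀ n) ^ 4 + W.psi0 o.1 (η₀ n) ^ 4 := fun o => by
    have a1 : 0 ≤ W.psi1 o.1 (η₀ n) ^ 4 := by positivity
    have a0 : 0 ≤ W.psi0 o.1 (η₀ n) ^ 4 := by positivity
    by_cases h : 0 ≤ gstar n o.2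
    · simp only [hG, gain, h, not_lt.2 h, if_true, if_false, mul_one, mul_zero, add_zero]
      linarith
    · simp only [hG, gain, h, not_le.1 h, if_true, if_false, mul_one, mul_zero, zero_add]
      linarith
  have iG4 : Integrable (fun o => G o ^ 4) (P n) :=
    (j1.add j0).mono' (hGm.pow_const 4).aestronglyMeasurable (Eventually.of_forall fun o => by
      rw [Real.norm_eq_abs, abs_of_nonneg (by positivity)]; exact hG4 o)
  have iG : Integrable G (P n) := integrable_of_integrable_pow_four hGm iG4
  have bG4 : ∫ o, G o ^ 4 ∂(P n) ≤ 2 * K := by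
    have := integral_mono iG4 (j1.add j0) hG4
    simp only [Pi.add_apply] at this
    rw [integral_add j1 j0] at this
    linarith
  obtain ⟨u, R, hu⟩ := exists_isRegularSurrogate hmeas hweights hφ hgstar hη₀ hbdd n
  -- The zero set lies in every set `|g_*| ≤ ε`, whose probability can be made smaller than any `ρ`.
  have hz : P n {o | gstar n o.2 = 0} = 0 := by
    refine le_antisymm (ENNReal.le_of_forall_pos_le_add fun ρ hρ _ => ?_) zero_le
    obtain ⟨ε, hε, h⟩ := exists_measure_abs_gstar_le hmeas hweights hφ hgstar hη₀ hbdd hmargin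
      (ρ := ρ) (by exact_mod_cast hρ)
    refine (measure_mono fun o ho => ?_).trans ((h n).trans (by simp))
    simp only [Set.mem_ofPred_eq] at ho ⊢
    simp [ho, hε.le]
  have hV : optimalValue W (P n) (η₀ n) = ∫ o, G o ∂(P n) :=
    R.optimalValue_eq hφ.deriv_neg i1 i0 hz
  set V := optimalValue W (P n) (η₀ n) with hVdef
  have hVb : |V| ≤ 1 + 2 * K := by
    rw [hV]
    refine (abs_integral_le_integral_abs).trans ?_
    have : ∫ o, |G o| ∂(P n) ≤ ∫ o, (1 + G o ^ 4) ∂(P n) := by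
      refine integral_mono iG.abs ((integrable_const 1).add iG4) fun o => ?_
      simp only [abs_le]
      constructor <;> nlinarith [sq_nonneg (G o ^ 2 - 1), sq_nonneg (G o - 1),
        sq_nonneg (G o + 1), sq_nonneg (G o ^ 2)]
    rw [integral_add (integrable_const 1) iG4] at this
    simp only [integral_const, probReal_univ, smul_eq_mul, mul_one] at this
    linarith
  have hS4 : ∀ o, score W (P n) (η₀ n) (gstar n) o ^ 4 ≤ 8 * G o ^ 4 + 8 * (1 + 2 * K) ^ 4 :=
    fun o => by
    have hV4 : V ^ 4 ≤ (1 + 2 * K) ^ 4 := by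
      rw [← Even.pow_abs (by decide : Even 4) V]
      exact pow_le_pow_left₀ (abs_nonneg V) hVb 4
    have : (G o - V) ^ 4 ≤ 8 * G o ^ 4 + 8 * V ^ 4 := by
      have h1 : (G o - V) ^ 2 ≤ 2 * (G o ^ 2 + V ^ 2) := by nlinarith [sq_nonneg (G o + V)]
      have h2 := pow_le_pow_left₀ (sq_nonneg _) h1 2
      nlinarith [sq_nonneg (G o ^ 2 - V ^ 2)]
    simp only [score]
    linarith
  have hSm : Measurable (score W (P n) (η₀ n) (gstar n)) := hGm.sub measurable_const
  have hdom : Integrable (fun o => 8 * G o ^ 4 + 8 * (1 + 2 * K) ^ 4) (P n) :=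
    (iG4.const_mul 8).add (integrable_const _)
  have iS4 : Integrable (fun o => score W (P n) (η₀ n) (gstar n) o ^ 4) (P n) :=
    hdom.mono' (hSm.pow_const 4).aestronglyMeasurable
      (Eventually.of_forall fun o => by
        rw [Real.norm_eq_abs, abs_of_nonneg (by positivity)]; exact hS4 o)
  refine ⟨hSm, iS4, ?_, ?_⟩
  · refine (integral_mono iS4 hdom hS4).trans ?_
    rw [integral_add (iG4.const_mul 8) (integrable_const _), integral_const_mul]
    simp only [integral_const, probReal_univ, smul_eq_mul, one_mul]
    linarith
  · simp only [score]
    rw [integral_sub iG (integrable_const _), ← hV]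
    simp [hVdef]

end


/-! ### Estimation errors of the gains -/

/-- A bound of the squared estimation error of the gain at one observation: the errors of the
weights on the two sides of `g_k`, and everything where the surrogate policy is close to zero. -/
noncomputable def errorBound {𝒵 : Type*} {d r : ℕ} (W : Weights 𝒵 d r) (η η₀ : Vec d → Vec r)
    (gk gstar : Vec d → ℝ) (ε : ℝ) (o : Obs 𝒵 d) : ℝ :=
  ((W.psi1 o.1 η - W.psi1 o.1 η₀) * (if -gk o.2 < 0 then 1 else 0)) ^ 2
    + ((W.psi0 o.1 η - W.psi0 o.1 η₀) * (if gk o.2 < 0 then 1 else 0)) ^ 2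
    + {o' : Obs 𝒵 d | |gstar o'.2| ≤ ε}.indicator (fun o' => 4 * W.psi1 o'.1 η ^ 2
      + 4 * W.psi0 o'.1 η ^ 2 + 4 * W.psi1 o'.1 η₀ ^ 2 + 4 * W.psi0 o'.1 η₀ ^ 2) o

lemma errorBound_nonneg {𝒵 : Type*} {d r : ℕ} (W : Weights 𝒵 d r) (η η₀ : Vec d → Vec r)
    (gk gstar : Vec d → ℝ) (ε : ℝ) (o : Obs 𝒵 d) : 0 ≤ errorBound W η η₀ gk gstar ε o :=
  add_nonneg (by positivity) (Set.indicator_nonneg (fun _ _ => by positivity) _)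

/-- The two versions of the estimated gain (which differ in the treatment of `g = 0`) are close to
the gain at the true nuisance function and the surrogate policy. -/
lemma sq_gain_sub_le {𝒵 : Type*} {d r : ℕ} (W : Weights 𝒵 d r) (η η₀ : Vec d → Vec r)
    (g gk gstar : Vec d → ℝ) {e : ℝ} (o : Obs 𝒵 d) (h1 : |g o.2 - gk o.2| ≤ e)
    (h2 : |gstar o.2 - gk o.2| ≤ e) :
    (gain W η g o - gain W η₀ gstar o) ^ 2 ≤ errorBound W η η₀ gk gstar (3 * e) o ∧
    (W.psi1 o.1 η * (if -g o.2 < 0 then 1 else 0) + W.psi0 o.1 η * (if g o.2 < 0 then 1 else 0)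
      - gain W η₀ gstar o) ^ 2 ≤ errorBound W η η₀ gk gstar (3 * e) o := by
  have he : 0 ≤ e := (abs_nonneg _).trans h1
  have h1' := abs_le.1 h1
  have h2' := abs_le.1 h2
  -- Near zero the indicators are not compared at all. Otherwise `g_k` is within `e` and `g` within
  -- `2e` of `g_*`, so all three share a strict sign and only the weight error on that side remains.
  by_cases hs : |gstar o.2| ≤ 3 * e
  · have hb : 4 * W.psi1 o.1 η ^ 2 + 4 * W.psi0 o.1 η ^ 2 + 4 * W.psi1 o.1 η₀ ^ 2
        + 4 * W.psi0 o.1 η₀ ^ 2 ≤ errorBound W η η₀ gk gstar (3 * e) o := by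
      have hmem : o ∈ {o' : Obs 𝒵 d | |gstar o'.2| ≤ 3 * e} := hs
      rw [errorBound, Set.indicator_of_mem hmem]
      have : 0 ≤ ((W.psi1 o.1 η - W.psi1 o.1 η₀) * (if -gk o.2 < 0 then 1 else 0)) ^ 2
        + ((W.psi0 o.1 η - W.psi0 o.1 η₀) * (if gk o.2 < 0 then 1 else 0)) ^ 2 := by positivity
      linarith
    have hpair : ∀ a b : ℝ, (a ^ 2 ≤ W.psi1 o.1 η ^ 2 + W.psi0 o.1 η ^ 2) →
        (b ^ 2 ≤ W.psi1 o.1 η₀ ^ 2 + W.psi0 o.1 η₀ ^ 2) →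
        (a - b) ^ 2 ≤ errorBound W η η₀ gk gstar (3 * e) o := fun a b ha hb' => by
      nlinarith [sq_nonneg (a + b), sq_nonneg (W.psi1 o.1 η), sq_nonneg (W.psi0 o.1 η),
        sq_nonneg (W.psi1 o.1 η₀), sq_nonneg (W.psi0 o.1 η₀)]
    have hg : ∀ (η' : Vec d → Vec r) (g' : Vec d → ℝ),
        gain W η' g' o ^ 2 ≤ W.psi1 o.1 η' ^ 2 + W.psi0 o.1 η' ^ 2 := fun η' g' => by
      by_cases h : 0 ≤ g' o.2
      · simp [gain, h, not_lt.2 h, sq_nonneg]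
      · simp [gain, h, not_le.1 h, sq_nonneg]
    refine ⟨hpair _ _ (hg _ _) (hg _ _), hpair _ _ ?_ (hg _ _)⟩
    rcases lt_trichotomy (g o.2) 0 with h | h | h
    · simp [h, not_lt.2 h.le, sq_nonneg]
    -- At `g = 0` both strict indicators vanish, so this version of the gain is zero.
    · simp only [h, neg_zero, lt_irrefl, if_false, mul_zero, add_zero]
      nlinarith [sq_nonneg (W.psi1 o.1 η), sq_nonneg (W.psi0 o.1 η)]
    · simp [h, not_lt.2 h.le, sq_nonneg]
  · have hmem : o ∉ {o' : Obs 𝒵 d | |gstar o'.2| ≤ 3 * e} := hs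
    rw [errorBound, Set.indicator_of_notMem hmem, add_zero]
    rcases lt_abs.1 (not_le.1 hs) with h | h
    · have hk : 0 < gk o.2 := by linarith
      have hg : 0 < g o.2 := by linarith
      have hst : 0 < gstar o.2 := by linarith
      simp [gain, hk, hg, hg.le, hst.le, not_lt.2 hk.le, not_lt.2 hg.le, not_lt.2 hst.le]
    · have hk : gk o.2 < 0 := by linarith
      have hg : g o.2 < 0 := by linarith
      have hst : gstar o.2 < 0 := by linarith
      simp [gain, hk, hg, hst, not_le.2 hg, not_le.2 hst, not_lt.2 hk.le, not_lt.2 hg.le]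

/-- Perturbation of an empirical variance. -/
lemma abs_average_sq_sub_le {n : ℕ} (hn : n ≠ 0) (a v s F : Fin n → ℝ) (V₀ τ : ℝ) (hτ : 0 < τ)
    (ha : ∀ i, (a i - s i) ^ 2 ≤ F i) (hv : ∀ i, (v i - s i) ^ 2 ≤ F i) :
    |1 / (n : ℝ) * ∑ i, (a i - 1 / (n : ℝ) * ∑ j, v j) ^ 2
      - 1 / (n : ℝ) * ∑ i, (s i - V₀) ^ 2|
      ≤ (6 * (1 / (n : ℝ) * ∑ i, F i) + 4 * (1 / (n : ℝ) * ∑ i, (s i - V₀)) ^ 2) * (1 + 1 / τ)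
        + τ * (1 / (n : ℝ) * ∑ i, (s i - V₀) ^ 2) := by
  have hn' : (0 : ℝ) < n := by exact_mod_cast Nat.pos_of_ne_zero hn
  set c : ℝ := 1 / (n : ℝ) with hc
  have hc0 : 0 < c := by positivity
  have hcn : c * n = 1 := by rw [hc]; field_simp
  set V := c * ∑ j, v j with hV
  set A := c * ∑ i, F i with hA
  set D := c * ∑ i, (s i - V₀) with hD
  set Q := c * ∑ i, ((a i - V) - (s i - V₀)) ^ 2 with hQ
  set R := c * ∑ i, (s i - V₀) ^ 2 with hR
  -- The quantity `V - V₀ - D` is the average of `v - s`, so Cauchy-Schwarz bounds its square by the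
  -- average of `F`.
  have hVD : (V - V₀ - D) ^ 2 ≤ A := by
    have e : V - V₀ - D = c * ∑ i, (v i - s i) := by
      rw [hV, hD, Finset.sum_sub_distrib, Finset.sum_sub_distrib]
      simp only [Finset.sum_const, Finset.card_univ, Fintype.card_fin, nsmul_eq_mul]
      linear_combination V₀ * hcn
    have h := sq_sum_le_card_mul_sum_sq (s := Finset.univ) (f := fun i : Fin n => v i - s i)
    simp only [Finset.card_univ, Fintype.card_fin] at h
    have h' : ∑ i, (v i - s i) ^ 2 ≤ ∑ i, F i := Finset.sum_le_sum fun i _ => hv i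
    calc (V - V₀ - D) ^ 2 = c ^ 2 * (∑ i, (v i - s i)) ^ 2 := by rw [e]; ring
      _ ≤ c ^ 2 * (n * ∑ i, F i) := by
          refine mul_le_mul_of_nonneg_left (h.trans ?_) (sq_nonneg c)
          exact mul_le_mul_of_nonneg_left h' hn'.le
      _ = (c * n) * A := by rw [hA]; ring
      _ = A := by rw [hcn, one_mul]
  have hV2 : (V - V₀) ^ 2 ≤ 2 * A + 2 * D ^ 2 := by
    nlinarith [sq_nonneg (V - V₀ - D - D)]
  have hQle : Q ≤ 6 * A + 4 * D ^ 2 := by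
    have h1 : ∑ i, ((a i - V) - (s i - V₀)) ^ 2 ≤ ∑ i, (2 * F i + 2 * (V - V₀) ^ 2) :=
      Finset.sum_le_sum fun i _ => by
        nlinarith [ha i, sq_nonneg ((a i - s i) + (V - V₀))]
    rw [Finset.sum_add_distrib, ← Finset.mul_sum] at h1
    simp only [Finset.sum_const, Finset.card_univ, Fintype.card_fin, nsmul_eq_mul] at h1
    have h2 := mul_le_mul_of_nonneg_left h1 hc0.le
    have h3 : c * (2 * ∑ i, F i + n * (2 * (V - V₀) ^ 2)) = 2 * A + 2 * (V - V₀) ^ 2 := by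
      rw [hA]
      linear_combination 2 * (V - V₀) ^ 2 * hcn
    linarith
  -- Young's inequality with weight `τ`: the cross term in `(x + y)² - y²` is split so that the
  -- non-vanishing part `y²` carries the small factor `τ`.
  have hterm : ∀ i, |(a i - V) ^ 2 - (s i - V₀) ^ 2|
      ≤ (1 + 1 / τ) * ((a i - V) - (s i - V₀)) ^ 2 + τ * (s i - V₀) ^ 2 := fun i => by
    set x := (a i - V) - (s i - V₀) with hx
    set y := s i - V₀ with hy
    have e : (a i - V) ^ 2 - y ^ 2 = x ^ 2 + 2 * x * y := by rw [hx]; ring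
    have hm : 2 * |x * y| ≤ 1 / τ * x ^ 2 + τ * y ^ 2 := by
      have h : 0 ≤ 1 / τ * (|x| - τ * |y|) ^ 2 := by positivity
      have h2 : 1 / τ * (|x| - τ * |y|) ^ 2
          = 1 / τ * |x| ^ 2 - 2 * (|x| * |y|) + τ * |y| ^ 2 := by field_simp; ring
      rw [h2, sq_abs, sq_abs, ← abs_mul] at h
      linarith
    rw [e]
    have h5 := abs_add_le (x ^ 2) (2 * x * y)
    rw [abs_of_nonneg (sq_nonneg x), mul_assoc, abs_mul, abs_two] at h5
    rw [mul_assoc]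
    linarith
  have hsum : |c * ∑ i, (a i - V) ^ 2 - R| ≤ (1 + 1 / τ) * Q + τ * R := by
    rw [hR, ← mul_sub, ← Finset.sum_sub_distrib, abs_mul, abs_of_pos hc0]
    have h := (Finset.abs_sum_le_sum_abs (fun i => (a i - V) ^ 2 - (s i - V₀) ^ 2)
      Finset.univ).trans (Finset.sum_le_sum fun i _ => hterm i)
    rw [Finset.sum_add_distrib, ← Finset.mul_sum, ← Finset.mul_sum] at h
    have h2 := mul_le_mul_of_nonneg_left h hc0.le
    rw [hQ]
    linarith
  have hτ' : 0 < 1 + 1 / τ := by positivity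
  have := mul_le_mul_of_nonneg_left hQle hτ'.le
  linarith

lemma valueHat_eq {𝒵 : Type*} {d r m : ℕ} (W : Weights 𝒵 d r) (S : Estimators 𝒵 d r m) (n : ℕ)
    (w : Fin n → Obs 𝒵 d) :
    valueHat W S n w = 1 / (n : ℝ) * ∑ i,
      (W.psi1 (w i).1 (S.eta n (S.fold n i) w) * (if -S.gHat n w (w i).2 < 0 then 1 else 0)
        + W.psi0 (w i).1 (S.eta n (S.fold n i) w) * (if S.gHat n w (w i).2 < 0 then 1 else 0)) := by
  rw [valueHat]
  congr 1
  rw [← Fintype.sum_fiberwise (S.fold n)]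
  refine Finset.sum_congr rfl fun l _ => Finset.sum_congr rfl fun i _ => ?_
  rw [i.2]

/-- The first two terms are squared `L²` norms. On the event where `g_*` is small, Cauchy-Schwarz
trades each of four squares, weighted by 4, for a fourth moment and the root of the probability;
this gives the factor 16. -/
lemma lintegral_errorBound_le {W : Weights 𝒵 d r} {P : Measure (Obs 𝒵 d)}
    {η η₀ : Vec d → Vec r} {gk gstar : Vec d → ℝ} {ε : ℝ} {K : ℝ≥0∞}
    (hgk : Measurable gk) (hgs : Measurable gstar)
    (m1 : Measurable fun z => W.psi1 z η) (m0 : Measurable fun z => W.psi0 z η)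
    (m1' : Measurable fun z => W.psi1 z η₀) (m0' : Measurable fun z => W.psi0 z η₀)
    (k1 : ∫⁻ o, ENNReal.ofReal (W.psi1 o.1 η ^ 4) ∂P ≤ K)
    (k0 : ∫⁻ o, ENNReal.ofReal (W.psi0 o.1 η ^ 4) ∂P ≤ K)
    (k1' : ∫⁻ o, ENNReal.ofReal (W.psi1 o.1 η₀ ^ 4) ∂P ≤ K)
    (k0' : ∫⁻ o, ENNReal.ofReal (W.psi0 o.1 η₀ ^ 4) ∂P ≤ K) :
    ∫⁻ o, ENNReal.ofReal (errorBound W η η₀ gk gstar ε o) ∂P ≤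
      eLpNorm (fun o : Obs 𝒵 d =>
        (W.psi1 o.1 η - W.psi1 o.1 η₀) * (if -gk o.2 < 0 then 1 else 0)) 2 P ^ 2
      + eLpNorm (fun o : Obs 𝒵 d =>
        (W.psi0 o.1 η - W.psi0 o.1 η₀) * (if gk o.2 < 0 then 1 else 0)) 2 P ^ 2
      + 16 * (K ^ (1 / 2 : ℝ) * P {o | |gstar o.2| ≤ ε} ^ (1 / 2 : ℝ)) := by
  have hsq : ∀ f : Obs 𝒵 d → ℝ, ∫⁻ o, ENNReal.ofReal (f o ^ 2) ∂P = eLpNorm f 2 P ^ 2 :=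
    fun f => by
    have h := eLpNorm_nnreal_pow_eq_lintegral (μ := P) (f := f) (p := 2) two_ne_zero
    simp only [NNReal.coe_ofNat, ENNReal.coe_ofNat, ENNReal.rpow_two] at h
    rw [h]
    refine lintegral_congr fun o => ?_
    rw [Real.enorm_eq_ofReal_abs, ← ENNReal.ofReal_pow (abs_nonneg _), sq_abs]
  set A : Set (Obs 𝒵 d) := {o | |gstar o.2| ≤ ε} with hAdef
  have hA : MeasurableSet A :=
    measurableSet_le (hgs.comp measurable_snd).abs measurable_const
  have c1 : MeasurableSet {o : Obs 𝒵 d | -gk o.2 < 0} :=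
    measurableSet_lt (hgk.comp measurable_snd).neg measurable_const
  have c0 : MeasurableSet {o : Obs 𝒵 d | gk o.2 < 0} :=
    measurableSet_lt (hgk.comp measurable_snd) measurable_const
  set D1 : Obs 𝒵 d → ℝ := fun o =>
    (W.psi1 o.1 η - W.psi1 o.1 η₀) * (if -gk o.2 < 0 then 1 else 0) with hD1
  set D0 : Obs 𝒵 d → ℝ := fun o =>
    (W.psi0 o.1 η - W.psi0 o.1 η₀) * (if gk o.2 < 0 then 1 else 0) with hD0
  have n1 : Measurable fun o : Obs 𝒵 d => W.psi1 o.1 η := m1.comp measurable_fst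
  have n0 : Measurable fun o : Obs 𝒵 d => W.psi0 o.1 η := m0.comp measurable_fst
  have n1' : Measurable fun o : Obs 𝒵 d => W.psi1 o.1 η₀ := m1'.comp measurable_fst
  have n0' : Measurable fun o : Obs 𝒵 d => W.psi0 o.1 η₀ := m0'.comp measurable_fst
  have mD1 : Measurable D1 :=
    (n1.sub n1').mul (Measurable.ite c1 measurable_const measurable_const)
  have mD0 : Measurable D0 :=
    (n0.sub n0').mul (Measurable.ite c0 measurable_const measurable_const)
  have hpw : ∀ o, ENNReal.ofReal (errorBound W η η₀ gk gstar ε o)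
      = ENNReal.ofReal (D1 o ^ 2) + ENNReal.ofReal (D0 o ^ 2)
        + A.indicator (fun o' : Obs 𝒵 d => 4 * ENNReal.ofReal (W.psi1 o'.1 η ^ 2)
          + 4 * ENNReal.ofReal (W.psi0 o'.1 η ^ 2) + 4 * ENNReal.ofReal (W.psi1 o'.1 η₀ ^ 2)
          + 4 * ENNReal.ofReal (W.psi0 o'.1 η₀ ^ 2)) o := fun o => by
    rw [errorBound, ENNReal.ofReal_add (by positivity)
      (Set.indicator_nonneg (fun _ _ => by positivity) _),
      ENNReal.ofReal_add (by positivity) (by positivity)]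
    congr 1
    by_cases ho : o ∈ A
    · rw [Set.indicator_of_mem ho, Set.indicator_of_mem ho,
        ENNReal.ofReal_add (by positivity) (by positivity),
        ENNReal.ofReal_add (by positivity) (by positivity),
        ENNReal.ofReal_add (by positivity) (by positivity)]
      simp only [ENNReal.ofReal_mul (show (0 : ℝ) ≤ 4 by norm_num), ENNReal.ofReal_ofNat]
    · rw [Set.indicator_of_notMem ho, Set.indicator_of_notMem ho, ENNReal.ofReal_zero]
  simp_rw [hpw]
  rw [lintegral_add_left (by fun_prop), lintegral_add_left (by fun_prop), hsq, hsq,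
    lintegral_indicator hA]
  refine add_le_add le_rfl ?_
  rw [lintegral_add_left (by fun_prop), lintegral_add_left (by fun_prop),
    lintegral_add_left (by fun_prop), lintegral_const_mul _ (by fun_prop),
    lintegral_const_mul _ (by fun_prop), lintegral_const_mul _ (by fun_prop),
    lintegral_const_mul _ (by fun_prop)]
  have b1 := setLIntegral_sq_le n1 k1 hA
  have b0 := setLIntegral_sq_le n0 k0 hA
  have b1' := setLIntegral_sq_le n1' k1' hA
  have b0' := setLIntegral_sq_le n0' k0' hA
  calc _ ≤ 4 * (K ^ (1 / 2 : ℝ) * P A ^ (1 / 2 : ℝ)) + 4 * (K ^ (1 / 2 : ℝ) * P A ^ (1 / 2 : ℝ))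
        + 4 * (K ^ (1 / 2 : ℝ) * P A ^ (1 / 2 : ℝ))
        + 4 * (K ^ (1 / 2 : ℝ) * P A ^ (1 / 2 : ℝ)) := by gcongr
    _ = _ := by ring

/-! ### Consistency of the bootstrap variance -/

lemma abs_sub_le_of_supDist_le {P : Measure (Obs 𝒵 d)} {f g : Vec d → ℝ} {e : ℝ} (he : 0 ≤ e)
    (h : supDist P f g ≤ ENNReal.ofReal e) {x : Vec d} (hx : x ∈ covSupport P) :
    |f x - g x| ≤ e := by
  have h1 : ENNReal.ofReal |f x - g x| ≤ supDist P f g :=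
    le_iSup₂ (f := fun x (_ : x ∈ covSupport P) => ENNReal.ofReal |f x - g x|) x hx
  exact (ENNReal.ofReal_le_ofReal_iff he).1 (h1.trans h)

/-- Uniform distances are taken over the support only; this makes them usable at the sample points.
-/
lemma ae_mem_covSupport (P : Measure (Obs 𝒵 d)) [IsProbabilityMeasure P] (n : ℕ) :
    ∀ᵐ w ∂(sampleLaw P n), ∀ i, (w i).2 ∈ covSupport P := by
  refine ae_all_iff.2 fun i => ?_
  have h1 : ∀ᵐ x ∂(P.map Prod.snd), x ∈ covSupport P := Measure.support_mem_ae
  have h2 : ∀ᵐ o ∂P, o.2 ∈ covSupport P := ae_of_ae_map measurable_snd.aemeasurable h1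
  exact (measurePreserving_eval (fun _ : Fin n => P) i).quasiMeasurePreserving.ae h2

lemma tendsto_zero_of_sqrt_mul {s : ℕ → ℝ≥0∞}
    (h : Tendsto (fun n : ℕ => ENNReal.ofReal √(n : ℝ) * s n) atTop (𝓝 0)) :
    Tendsto s atTop (𝓝 0) := by
  refine tendsto_of_tendsto_of_tendsto_of_le_of_le' tendsto_const_nhds h
    (Eventually.of_forall fun _ => zero_le) ?_
  filter_upwards [eventually_ge_atTop 1] with n hn
  have : (1 : ℝ≥0∞) ≤ ENNReal.ofReal √(n : ℝ) := by
    rw [← ENNReal.ofReal_one]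
    refine ENNReal.ofReal_le_ofReal ?_
    rw [Real.one_le_sqrt]
    exact_mod_cast hn
  calc s n = 1 * s n := (one_mul _).symm
    _ ≤ _ := by gcongr

/-- Since `n^{-1/2} ≤ n^{-1/4}`, a single radius `n^{-1/4}` can serve for the sieve bias and for the
error of `ĝ`. -/
lemma eventually_le_rpow_of_sqrt_mul {s : ℕ → ℝ≥0∞}
    (h : Tendsto (fun n : ℕ => ENNReal.ofReal √(n : ℝ) * s n) atTop (𝓝 0)) :
    ∀ᶠ n : ℕ in atTop, s n ≤ ENNReal.ofReal ((n : ℝ) ^ (-(1 / 4) : ℝ)) := by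
  filter_upwards [h.eventually (gt_mem_nhds one_pos), eventually_ge_atTop 1] with n hn h1
  have h1' : (1 : ℝ) ≤ n := by exact_mod_cast h1
  have hs : 0 < √(n : ℝ) := Real.sqrt_pos.2 (by linarith)
  have h2 : s n ≤ (ENNReal.ofReal √(n : ℝ))⁻¹ := by
    rw [ENNReal.le_inv_iff_mul_le, mul_comm]
    exact hn.le
  refine h2.trans ?_
  rw [← ENNReal.ofReal_inv_of_pos hs]
  refine ENNReal.ofReal_le_ofReal ?_
  rw [Real.sqrt_eq_rpow, ← Real.rpow_neg (by linarith)]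
  exact Real.rpow_le_rpow_of_exponent_le h1' (by norm_num)

lemma PolicyRate.measurable_gk {W : Weights 𝒵 d r} {H : Set (Vec d → Vec r)}
    {p : ℕ → Vec d → ℝ} {k : ℕ → ℕ} {S : Estimators 𝒵 d r m} {P : ℕ → Measure (Obs 𝒵 d)}
    {gstar gk : ℕ → Vec d → ℝ} (hrate : PolicyRate p k P gstar gk S)
    (hmeas : MeasurabilityConditions W H p S) (n : ℕ) : Measurable (gk n) := by
  obtain ⟨β, hβ⟩ := hrate.mem n
  rw [hβ]
  exact Finset.measurable_sum _ fun j _ => (hmeas.basis j).const_mul _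

section

variable {W : Weights 𝒵 d r} {H : Set (Vec d → Vec r)} {φ : ℝ → ℝ} {p : ℕ → Vec d → ℝ}
  {k : ℕ → ℕ} {S : Estimators 𝒵 d r m} {P : ℕ → Measure (Obs 𝒵 d)}
  [∀ n, IsProbabilityMeasure (P n)]
  {η₀ : ℕ → Vec d → Vec r} {gstar gk : ℕ → Vec d → ℝ} {T : ℕ → Set (Vec d → Vec r)}

lemma measurable_errorBound_etaHat (hmeas : MeasurabilityConditions W H p S) {η : Vec d → Vec r}
    (hη : η ∈ H) {g g' : Vec d → ℝ} (hg : Measurable g) (hg' : Measurable g') (ε : ℝ) (n : ℕ)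
    (l : Fin m) :
    Measurable fun y : ({i : Fin n // S.fold n i ≠ l} → Obs 𝒵 d) × Obs 𝒵 d =>
      errorBound W (S.etaHat n l y.1) η g g' ε y.2 := by
  have hsw : Measurable fun y : ({i : Fin n // S.fold n i ≠ l} → Obs 𝒵 d) × Obs 𝒵 d =>
      (y.1, y.2.1) := by fun_prop
  have a1 : Measurable fun y : ({i : Fin n // S.fold n i ≠ l} → Obs 𝒵 d) × Obs 𝒵 d =>
      W.psi1 y.2.1 (S.etaHat n l y.1) := (hmeas.psi1Hat n l).comp hsw
  have a0 : Measurable fun y : ({i : Fin n // S.fold n i ≠ l} → Obs 𝒵 d) × Obs 𝒵 d =>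
      W.psi0 y.2.1 (S.etaHat n l y.1) := (hmeas.psi0Hat n l).comp hsw
  have b1 : Measurable fun y : ({i : Fin n // S.fold n i ≠ l} → Obs 𝒵 d) × Obs 𝒵 d =>
      W.psi1 y.2.1 η := (hmeas.psi1 hη).comp (measurable_fst.comp measurable_snd)
  have b0 : Measurable fun y : ({i : Fin n // S.fold n i ≠ l} → Obs 𝒵 d) × Obs 𝒵 d =>
      W.psi0 y.2.1 η := (hmeas.psi0 hη).comp (measurable_fst.comp measurable_snd)
  have c : Measurable fun y : ({i : Fin n // S.fold n i ≠ l} → Obs 𝒵 d) × Obs 𝒵 d =>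
      g y.2.2 := hg.comp (measurable_snd.comp measurable_snd)
  have c' : Measurable fun y : ({i : Fin n // S.fold n i ≠ l} → Obs 𝒵 d) × Obs 𝒵 d =>
      |g' y.2.2| := (hg'.comp (measurable_snd.comp measurable_snd)).abs
  have d1 : Measurable fun y : ({i : Fin n // S.fold n i ≠ l} → Obs 𝒵 d) × Obs 𝒵 d =>
      if -g y.2.2 < 0 then (1 : ℝ) else 0 :=
    Measurable.ite (measurableSet_lt c.neg measurable_const) measurable_const measurable_const
  have d0 : Measurable fun y : ({i : Fin n // S.fold n i ≠ l} → Obs 𝒵 d) × Obs 𝒵 d =>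
      if g y.2.2 < 0 then (1 : ℝ) else 0 :=
    Measurable.ite (measurableSet_lt c measurable_const) measurable_const measurable_const
  have e := Measurable.indicator (f := fun y :
      ({i : Fin n // S.fold n i ≠ l} → Obs 𝒵 d) × Obs 𝒵 d =>
      4 * W.psi1 y.2.1 (S.etaHat n l y.1) ^ 2 + 4 * W.psi0 y.2.1 (S.etaHat n l y.1) ^ 2
        + 4 * W.psi1 y.2.1 η ^ 2 + 4 * W.psi0 y.2.1 η ^ 2) (by fun_prop)
    (measurableSet_le c' (measurable_const (a := ε)))
  exact (((((a1.sub b1).mul d1).pow_const 2).add (((a0.sub b0).mul d0).pow_const 2)).add e)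

/-- The average estimation error of the gains is negligible. -/
lemma tendsto_measure_average_errorBound (hmeas : MeasurabilityConditions W H p S)
    (hweights : WeightConditions W H P η₀) (hφ : SurrogateConditions φ)
    (hgstar : ∀ n, IsSurrogatePolicy W φ (P n) (η₀ n) (gstar n))
    (hgk : ∀ n, Measurable (gk n)) (hmargin : MarginCondition W P η₀)
    (hnuis : NuisanceRate W H P η₀ gk S T) (hbdd : BoundednessConditions W H P η₀)
    {ε : ℕ → ℝ} (hε : Tendsto ε atTop (𝓝 0)) {t : ℝ} (ht : 0 < t) :
    Tendsto (fun n : ℕ => sampleLaw (P n) n {w | t ≤ 1 / (n : ℝ) * ∑ i,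
      errorBound W (S.eta n (S.fold n i) w) (η₀ n) (gk n) (gstar n) (ε n) (w i)})
      atTop (𝓝 0) := by
  obtain ⟨K, hK, hKb⟩ := exists_fourth_moment_bound hbdd
  set q : ℕ → ℝ≥0∞ := fun n => P n {o | |gstar n o.2| ≤ ε n} with hq
  have hq0 : Tendsto q atTop (𝓝 0) := by
    rw [ENNReal.tendsto_nhds_zero]
    intro ρ hρ
    rcases eq_or_ne ρ ∞ with rfl | hρ'
    · exact Eventually.of_forall fun _ => le_top
    obtain ⟨ε', hε', hb⟩ := exists_measure_abs_gstar_le hmeas hweights hφ hgstar hnuis.mem hbdd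
      hmargin (ENNReal.toReal_pos hρ.ne' hρ')
    filter_upwards [hε.eventually (gt_mem_nhds hε')] with n hn
    refine (measure_mono fun o ho => ?_).trans ((hb n).trans (ENNReal.ofReal_toReal hρ').le)
    have ho' : |gstar n o.2| ≤ ε n := ho
    exact ho'.trans hn.le
  set s1 : ℕ → ℝ≥0∞ := fun n => ⨆ η ∈ T n, eLpNorm (fun o : Obs 𝒵 d =>
    (W.psi1 o.1 η - W.psi1 o.1 (η₀ n)) * (if -gk n o.2 < 0 then 1 else 0)) 2 (P n) with hs1
  set s0 : ℕ → ℝ≥0∞ := fun n => ⨆ η ∈ T n, eLpNorm (fun o : Obs 𝒵 d =>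
    (W.psi0 o.1 η - W.psi0 o.1 (η₀ n)) * (if gk n o.2 < 0 then 1 else 0)) 2 (P n) with hs0
  have hs1lim : Tendsto s1 atTop (𝓝 0) := tendsto_zero_of_sqrt_mul hnuis.meanSq1
  have hs0lim : Tendsto s0 atTop (𝓝 0) := tendsto_zero_of_sqrt_mul hnuis.meanSq0
  -- A bound on the mean of `errorBound` valid simultaneously for all nuisance functions in `T n`.
  -- The conditional mean given the other folds can exceed it only if the estimate leaves `T n`.
  set rr : ℕ → ℝ≥0∞ := fun n => s1 n ^ 2 + s0 n ^ 2
    + 16 * (ENNReal.ofReal K ^ (1 / 2 : ℝ) * q n ^ (1 / 2 : ℝ)) with hrr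
  have hrlim : Tendsto rr atTop (𝓝 0) := by
    have h1 : Tendsto (fun n => s1 n ^ 2) atTop (𝓝 0) := by
      simpa using ENNReal.Tendsto.pow (n := 2) hs1lim
    have h0 : Tendsto (fun n => s0 n ^ 2) atTop (𝓝 0) := by
      simpa using ENNReal.Tendsto.pow (n := 2) hs0lim
    have h2 : Tendsto (fun n => q n ^ (1 / 2 : ℝ)) atTop (𝓝 0) := by
      simpa using hq0.ennrpow_const (1 / 2 : ℝ)
    have h3 : Tendsto (fun n => ENNReal.ofReal K ^ (1 / 2 : ℝ) * q n ^ (1 / 2 : ℝ))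
        atTop (𝓝 0) := by
      simpa using ENNReal.Tendsto.const_mul h2
        (Or.inr (ENNReal.rpow_ne_top_of_nonneg (by norm_num) ENNReal.ofReal_ne_top))
    have h4 : Tendsto (fun n => 16 * (ENNReal.ofReal K ^ (1 / 2 : ℝ) * q n ^ (1 / 2 : ℝ)))
        atTop (𝓝 0) := by
      simpa using ENNReal.Tendsto.const_mul h3 (Or.inr (by simp))
    have h5 := (h1.add h0).add h4
    simp only [add_zero] at h5
    exact h5
  have hbound : Tendsto (fun n => (∑ l, sampleLaw (P n) n {w | S.eta n l w ∉ T n})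
      + rr n / ENNReal.ofReal t) atTop (𝓝 0) := by
    have h1 : Tendsto (fun n => ∑ l, sampleLaw (P n) n {w | S.eta n l w ∉ T n}) atTop (𝓝 0) := by
      simpa using tendsto_finsetSum Finset.univ fun l _ => hnuis.est_mem l
    have h2 : Tendsto (fun n => rr n / ENNReal.ofReal t) atTop (𝓝 0) := by
      simpa using ENNReal.Tendsto.div_const hrlim (Or.inr (by simpa using ht))
    simpa using h1.add h2
  refine tendsto_of_tendsto_of_tendsto_of_le_of_le' tendsto_const_nhds hbound
    (Eventually.of_forall fun _ => zero_le) ?_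
  filter_upwards [eventually_ge_atTop 1] with n hn
  have hn' : (0 : ℝ) < n := by exact_mod_cast hn
  set F : ∀ l : Fin m, ({j : Fin n // S.fold n j ≠ l} → Obs 𝒵 d) × Obs 𝒵 d → ℝ≥0∞ :=
    fun l y => ENNReal.ofReal
      (errorBound W (S.etaHat n l y.1) (η₀ n) (gk n) (gstar n) (ε n) y.2) with hF
  have hmk := measure_crossfit_average_le (P n) (by omega) (S.fold n) F
    (fun l => (measurable_errorBound_etaHat hmeas (hnuis.mem n) (hgk n) (hgstar n).measurable
      (ε n) n l).ennreal_ofReal) (rr n) (ENNReal.ofReal t) (by simpa using ht) (by simp)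
  refine (measure_mono fun w hw => ?_).trans (hmk.trans (add_le_add
    (Finset.sum_le_sum fun l _ => measure_mono fun w hw => ?_) le_rfl))
  · have hw' : t ≤ 1 / (n : ℝ) * ∑ i, errorBound W (S.eta n (S.fold n i) w) (η₀ n) (gk n)
      (gstar n) (ε n) (w i) := hw
    show ENNReal.ofReal t * n ≤ ∑ i, ENNReal.ofReal (errorBound W (S.eta n (S.fold n i) w) (η₀ n)
      (gk n) (gstar n) (ε n) (w i))
    rw [← ENNReal.ofReal_sum_of_nonneg fun i _ => errorBound_nonneg _ _ _ _ _ _ _,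
      ← ENNReal.ofReal_natCast, ← ENNReal.ofReal_mul ht.le]
    refine ENNReal.ofReal_le_ofReal ?_
    rw [one_div, inv_mul_eq_div, le_div_iff₀ hn'] at hw'
    exact hw'
  · intro hmem
    have hw' : rr n < ∫⁻ o, ENNReal.ofReal
      (errorBound W (S.eta n l w) (η₀ n) (gk n) (gstar n) (ε n) o) ∂(P n) := hw
    refine absurd hw' (not_lt.2 ?_)
    have hηH := hnuis.subset n hmem
    have h0H := hnuis.mem n
    refine (lintegral_errorBound_le (hgk n) (hgstar n).measurable (hmeas.psi1 hηH)
      (hmeas.psi0 hηH) (hmeas.psi1 h0H) (hmeas.psi0 h0H) (hKb n _ hηH).1 (hKb n _ hηH).2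
      (hKb n _ h0H).1 (hKb n _ h0H).2).trans ?_
    refine add_le_add (add_le_add (pow_le_pow_left' ?_ 2) (pow_le_pow_left' ?_ 2)) le_rfl
    · exact le_iSup₂ (f := fun η (_ : η ∈ T n) => eLpNorm (fun o : Obs 𝒵 d =>
        (W.psi1 o.1 η - W.psi1 o.1 (η₀ n)) * (if -gk n o.2 < 0 then 1 else 0)) 2 (P n)) _ hmem
    · exact le_iSup₂ (f := fun η (_ : η ∈ T n) => eLpNorm (fun o : Obs 𝒵 d =>
        (W.psi0 o.1 η - W.psi0 o.1 (η₀ n)) * (if gk n o.2 < 0 then 1 else 0)) 2 (P n)) _ hmem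

lemma tendsto_natCast_rpow_neg_quarter :
    Tendsto (fun n : ℕ => (n : ℝ) ^ (-(1 / 4) : ℝ)) atTop (𝓝 0) :=
  (tendsto_rpow_neg_atTop (by norm_num : (0 : ℝ) < 1 / 4)).comp tendsto_natCast_atTop_atTop

/-- The empirical variance of the estimated scores is consistent for `σ_v²`. -/
theorem tendsto_measure_scoreHat_variance (hmeas : MeasurabilityConditions W H p S)
    (hweights : WeightConditions W H P η₀) (hφ : SurrogateConditions φ)
    (hgstar : ∀ n, IsSurrogatePolicy W φ (P n) (η₀ n) (gstar n))
    (hrate : PolicyRate p k P gstar gk S) (hmargin : MarginCondition W P η₀)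
    (hnuis : NuisanceRate W H P η₀ gk S T) (hbdd : BoundednessConditions W H P η₀)
    {κ : ℝ} (hκ : 0 < κ) :
    Tendsto (fun n : ℕ => sampleLaw (P n) n {w | κ ≤ |1 / (n : ℝ) * ∑ i,
      scoreHat W S n w i (w i) ^ 2 - scoreVar W (P n) (η₀ n) (gstar n)|}) atTop (𝓝 0) := by
  obtain ⟨K, hK, hsc⟩ := exists_score_moments hmeas hweights hφ hgstar hnuis.mem hbdd hmargin
  set sc : ℕ → Obs 𝒵 d → ℝ := fun n => score W (P n) (η₀ n) (gstar n) with hscdef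
  have hsq : ∀ n, Integrable (fun o => sc n o ^ 2) (P n) ∧
      ∫ o, sc n o ^ 2 ∂(P n) ≤ 1 + K := fun n =>
    integrable_sq_of_integrable_pow_four (hsc n).1 (hsc n).2.1 (hsc n).2.2.1
  have hv : ∀ n, scoreVar W (P n) (η₀ n) (gstar n) ≤ 1 + K := fun n => (hsq n).2
  -- Error budget: `τ` times the empirical second moment (at most `K + 2`) costs `κ/8`, the
  -- perturbation term costs `κ/8` through `a`, and the law of large numbers for the squares costs
  -- `κ/2` through `b`. The sum stays below `κ`.
  set τ : ℝ := κ / (8 * (K + 2)) with hτ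
  have hτ0 : 0 < τ := by positivity
  set a : ℝ := min 1 (κ / (8 * (10 * (1 + 1 / τ)))) with ha
  have ha0 : 0 < a := lt_min one_pos (by positivity)
  have ha1 : a ≤ 1 := min_le_left _ _
  have haκ : 10 * a * (1 + 1 / τ) ≤ κ / 8 := by
    have h1 : a ≤ κ / (8 * (10 * (1 + 1 / τ))) := min_le_right _ _
    rw [le_div_iff₀ (by positivity)] at h1
    linarith
  set b : ℝ := min 1 (κ / 2) with hb
  have hb0 : 0 < b := lt_min one_pos (by positivity)
  have L1 := tendsto_measure_average_errorBound hmeas hweights hφ hgstar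
    (hrate.measurable_gk hmeas) hmargin hnuis hbdd
    (ε := fun n : ℕ => 3 * (n : ℝ) ^ (-(1 / 4) : ℝ))
    (by simpa using tendsto_natCast_rpow_neg_quarter.const_mul 3) ha0
  have L2 := tendsto_measure_average_sub_integral P sc
    (fun n => (memLp_two_iff_integrable_sq (hsc n).1.aestronglyMeasurable).2 (hsq n).1)
    (1 + K) (fun n => (hsq n).2) ha0
  -- Applied to the squared score, whose second moment is the fourth moment of the score.
  have L3 := tendsto_measure_average_sub_integral P (fun n o => sc n o ^ 2)
    (fun n => (memLp_two_iff_integrable_sq ((hsc n).1.pow_const 2).aestronglyMeasurable).2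
      (by simpa only [← pow_mul] using (hsc n).2.1)) K
    (fun n => by simpa only [← pow_mul] using (hsc n).2.2.1) hb0
  have L4 := hrate.rate 1 one_pos
  have hsum := ((L1.add L2).add L3).add L4
  simp only [add_zero] at hsum
  refine tendsto_of_tendsto_of_tendsto_of_le_of_le' tendsto_const_nhds hsum
    (Eventually.of_forall fun _ => zero_le) ?_
  filter_upwards [eventually_ge_atTop 1, eventually_le_rpow_of_sqrt_mul hrate.bias] with n hn hbias
  refine (measure_mono_ae ?_).trans ((measure_union_le _ _).trans (add_le_add
    ((measure_union_le _ _).trans (add_le_add (measure_union_le _ _) le_rfl)) le_rfl))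
  filter_upwards [ae_mem_covSupport (P n) n] with w hw hκw
  by_contra hnot
  have hκw' : κ ≤ |1 / (n : ℝ) * ∑ i, scoreHat W S n w i (w i) ^ 2
    - scoreVar W (P n) (η₀ n) (gstar n)| := hκw
  have hnot' : ¬ (((a ≤ 1 / (n : ℝ) * ∑ i, errorBound W (S.eta n (S.fold n i) w) (η₀ n) (gk n)
        (gstar n) (3 * (n : ℝ) ^ (-(1 / 4) : ℝ)) (w i)
      ∨ a ≤ |1 / (n : ℝ) * ∑ i, sc n (w i) - ∫ y, sc n y ∂(P n)|)
      ∨ b ≤ |1 / (n : ℝ) * ∑ i, sc n (w i) ^ 2 - ∫ y, sc n y ^ 2 ∂(P n)|)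
      ∨ ENNReal.ofReal (1 * (n : ℝ) ^ (-(1 / 4) : ℝ)) < supDist (P n) (S.gHat n w) (gk n)) := hnot
  push Not at hnot'
  obtain ⟨⟨⟨e1, e2⟩, e3⟩, e4⟩ := hnot'
  rw [one_mul] at e4
  have he : 0 ≤ (n : ℝ) ^ (-(1 / 4) : ℝ) := by positivity
  have hpt := fun i => sq_gain_sub_le W (S.eta n (S.fold n i) w) (η₀ n) (S.gHat n w) (gk n)
    (gstar n) (w i) (abs_sub_le_of_supDist_le he e4 (hw i))
    (abs_sub_le_of_supDist_le he hbias (hw i))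
  -- Two perturbed families enter: the gains in the score use `1{ĝ ≥ 0}`, while those averaged in
  -- `valueHat` use `1{-ĝ < 0}`. Both are within the same `errorBound` of the true gain.
  have hdet := abs_average_sq_sub_le (by omega : n ≠ 0)
    (fun i => gain W (S.eta n (S.fold n i) w) (S.gHat n w) (w i)) _
    (fun i => gain W (η₀ n) (gstar n) (w i)) _ (optimalValue W (P n) (η₀ n)) τ hτ0
    (fun i => (hpt i).1) (fun i => (hpt i).2)
  rw [← valueHat_eq] at hdet
  change |1 / (n : ℝ) * ∑ i, scoreHat W S n w i (w i) ^ 2 - 1 / (n : ℝ) * ∑ i, sc n (w i) ^ 2|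
    ≤ (6 * _ + 4 * (1 / (n : ℝ) * ∑ i, sc n (w i)) ^ 2) * (1 + 1 / τ)
      + τ * (1 / (n : ℝ) * ∑ i, sc n (w i) ^ 2) at hdet
  set A := 1 / (n : ℝ) * ∑ i, errorBound W (S.eta n (S.fold n i) w) (η₀ n) (gk n)
        (gstar n) (3 * (n : ℝ) ^ (-(1 / 4) : ℝ)) (w i) with hA
  set D := 1 / (n : ℝ) * ∑ i, sc n (w i) with hD
  set R := 1 / (n : ℝ) * ∑ i, sc n (w i) ^ 2 with hR
  have hmean : ∫ y, sc n y ∂(P n) = 0 := (hsc n).2.2.2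
  rw [hmean, sub_zero] at e2
  -- From `|D| < a` and `a ≤ 1`.
  have hD2 : D ^ 2 ≤ a := by
    have h1 := abs_lt.1 e2
    nlinarith
  have e3' : |R - scoreVar W (P n) (η₀ n) (gstar n)| < b := e3
  have hb1 : b ≤ 1 := min_le_left _ _
  have hbκ : b ≤ κ / 2 := min_le_right _ _
  have hRle : R ≤ K + 2 := by
    have := (abs_lt.1 e3').2
    linarith [hv n]
  have hτR : τ * R ≤ κ / 8 := by
    have h1 := mul_le_mul_of_nonneg_left hRle hτ0.le
    have h2 : τ * (K + 2) = κ / 8 := by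
      rw [hτ]
      field_simp
    linarith
  have hfirst : (6 * A + 4 * D ^ 2) * (1 + 1 / τ) ≤ κ / 8 := by
    refine le_trans (mul_le_mul_of_nonneg_right ?_ (by positivity)) haκ
    linarith
  have htri := abs_sub_le (1 / (n : ℝ) * ∑ i, scoreHat W S n w i (w i) ^ 2) R
    (scoreVar W (P n) (η₀ n) (gstar n))
  linarith

end

/-! ### The bootstrap statistic -/

/-- The centring term factors over the product measure and carries the Gaussian mean, which is zero.
The factorisation of the integral needs no integrability of the estimated score. -/
lemma bootStat_eq (W : Weights 𝒵 d r) (S : Estimators 𝒵 d r m) (P : Measure (Obs 𝒵 d))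
    [IsProbabilityMeasure P] (n : ℕ) (w : Fin n → Obs 𝒵 d) (δ : Fin n → ℝ) :
    bootStat W S P n w δ = ∑ i, √(n : ℝ) * (1 / (n : ℝ)) * scoreHat W S n w i (w i) * δ i := by
  have hc : ∀ i, ∫ t : Obs 𝒵 d × ℝ, scoreHat W S n w i t.1 * t.2 ∂(P.prod (gaussianReal 0 1)) = 0 :=
    fun i => by
    have h := integral_prod_mul (μ := P) (ν := gaussianReal 0 1) (scoreHat W S n w i)
      (fun x : ℝ => x)
    rw [h, integral_id_gaussianReal, mul_zero]
  simp only [bootStat, empProcess, hc, Finset.sum_const_zero, mul_zero, sub_zero]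
  rw [← mul_assoc, Finset.mul_sum]
  exact Finset.sum_congr rfl fun i _ => by ring

/-- Conditionally on the data the bootstrap statistic is Gaussian, with the empirical variance of
the estimated scores. -/
lemma integral_bootStat (W : Weights 𝒵 d r) (S : Estimators 𝒵 d r m) (P : Measure (Obs 𝒵 d))
    [IsProbabilityMeasure P] (n : ℕ) (w : Fin n → Obs 𝒵 d) (f : ℝ →ᵇ ℝ) :
    ∫ δ, f (bootStat W S P n w δ) ∂(multiplierLaw n)
      = ∫ t, f t ∂(gaussianReal 0 (1 / (n : ℝ) * ∑ i, scoreHat W S n w i (w i) ^ 2).toNNReal) := by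
  simp_rw [bootStat_eq]
  have h := map_multiplierLaw_sum n fun i => √(n : ℝ) * (1 / (n : ℝ)) * scoreHat W S n w i (w i)
  have hvar : ∑ i, (√(n : ℝ) * (1 / (n : ℝ)) * scoreHat W S n w i (w i)) ^ 2
      = 1 / (n : ℝ) * ∑ i, scoreHat W S n w i (w i) ^ 2 := by
    rw [Finset.mul_sum]
    refine Finset.sum_congr rfl fun i _ => ?_
    rw [mul_pow, mul_pow, Real.sq_sqrt (Nat.cast_nonneg n)]
    congr 1
    rcases eq_or_ne (n : ℝ) 0 with h0 | h0
    · simp [h0]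
    · field_simp
  rw [hvar] at h
  rw [← h, integral_map]
  · have : Measurable fun δ : Fin n → ℝ =>
        ∑ i, √(n : ℝ) * (1 / (n : ℝ)) * scoreHat W S n w i (w i) * δ i := by fun_prop
    exact this.aemeasurable
  · exact f.continuous.aestronglyMeasurable

lemma measurable_scoreHat {W : Weights 𝒵 d r} {H : Set (Vec d → Vec r)} {p : ℕ → Vec d → ℝ}
    {S : Estimators 𝒵 d r m} (hmeas : MeasurabilityConditions W H p S) (n : ℕ) (i : Fin n) :
    Measurable fun w : Fin n → Obs 𝒵 d => scoreHat W S n w i (w i) := by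
  have hg : ∀ i : Fin n, Measurable fun w : Fin n → Obs 𝒵 d => S.gHat n w (w i).2 := fun i =>
    (hmeas.gHat n).comp (g := fun y : (Fin n → Obs 𝒵 d) × Vec d => S.gHat n y.1 y.2)
      (f := fun w : Fin n → Obs 𝒵 d => (w, (w i).2)) (by fun_prop)
  have h1 : ∀ i : Fin n, Measurable fun w : Fin n → Obs 𝒵 d =>
      W.psi1 (w i).1 (S.eta n (S.fold n i) w) := fun i =>
    (hmeas.psi1Hat n (S.fold n i)).comp
      (f := fun w : Fin n → Obs 𝒵 d => ((fun j : {j : Fin n // S.fold n j ≠ S.fold n i} => w j.1),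
        (w i).1)) (by fun_prop)
  have h0 : ∀ i : Fin n, Measurable fun w : Fin n → Obs 𝒵 d =>
      W.psi0 (w i).1 (S.eta n (S.fold n i) w) := fun i =>
    (hmeas.psi0Hat n (S.fold n i)).comp
      (f := fun w : Fin n → Obs 𝒵 d => ((fun j : {j : Fin n // S.fold n j ≠ S.fold n i} => w j.1),
        (w i).1)) (by fun_prop)
  have c1 : ∀ i : Fin n, Measurable fun w : Fin n → Obs 𝒵 d =>
      if -S.gHat n w (w i).2 < 0 then (1 : ℝ) else 0 := fun i =>
    Measurable.ite (measurableSet_lt (hg i).neg measurable_const) measurable_const measurable_const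
  have c0 : ∀ i : Fin n, Measurable fun w : Fin n → Obs 𝒵 d =>
      if S.gHat n w (w i).2 < 0 then (1 : ℝ) else 0 := fun i =>
    Measurable.ite (measurableSet_lt (hg i) measurable_const) measurable_const measurable_const
  have c2 : Measurable fun w : Fin n → Obs 𝒵 d =>
      if 0 ≤ S.gHat n w (w i).2 then (1 : ℝ) else 0 :=
    Measurable.ite (measurableSet_le measurable_const (hg i)) measurable_const measurable_const
  simp only [scoreHat, valueHat_eq, gain]
  exact (((h1 i).mul c2).add ((h0 i).mul (c0 i))).sub ((Finset.measurable_sum _ fun j _ =>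
    ((h1 j).mul (c1 j)).add ((h0 j).mul (c0 j))).const_mul _)

lemma measurable_bootStat {W : Weights 𝒵 d r} {H : Set (Vec d → Vec r)} {p : ℕ → Vec d → ℝ}
    {S : Estimators 𝒵 d r m} (hmeas : MeasurabilityConditions W H p S) (P : Measure (Obs 𝒵 d))
    [IsProbabilityMeasure P] (n : ℕ) :
    Measurable fun y : (Fin n → Obs 𝒵 d) × (Fin n → ℝ) => bootStat W S P n y.1 y.2 := by
  simp_rw [bootStat_eq]
  refine Finset.measurable_sum _ fun i _ => ?_
  have h : Measurable fun y : (Fin n → Obs 𝒵 d) × (Fin n → ℝ) => scoreHat W S n y.1 i (y.1 i) :=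
    (measurable_scoreHat hmeas n i).comp measurable_fst
  have h2 : Measurable fun y : (Fin n → Obs 𝒵 d) × (Fin n → ℝ) => y.2 i := by fun_prop
  exact (h.const_mul _).mul h2

/-- Bounded random variables that converge to zero in probability converge to zero in mean. -/
lemma tendsto_integral_of_tendsto_measure {Ω : ℕ → Type*} [∀ n, MeasurableSpace (Ω n)]
    (μ : ∀ n, Measure (Ω n)) [∀ n, IsProbabilityMeasure (μ n)] (X : ∀ n, Ω n → ℝ)
    (hX : ∀ n, Measurable (X n)) (B : ℝ) (hB : ∀ n ω, |X n ω| ≤ B)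
    (h : ∀ ε : ℝ, 0 < ε → Tendsto (fun n => μ n {ω | ε ≤ |X n ω|}) atTop (𝓝 0)) :
    Tendsto (fun n => ∫ ω, X n ω ∂(μ n)) atTop (𝓝 0) := by
  rw [Metric.tendsto_atTop']
  intro ε hε
  have hlim : Tendsto (fun n => |B| * (μ n).real {ω | ε / 2 ≤ |X n ω|}) atTop (𝓝 0) := by
    have := (ENNReal.tendsto_toReal (ENNReal.zero_ne_top)).comp (h (ε / 2) (by positivity))
    simpa [Measure.real] using this.const_mul |B|
  obtain ⟨N, hN⟩ := eventually_atTop.1 (hlim.eventually (gt_mem_nhds (half_pos hε)))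
  refine ⟨N, fun n hn => ?_⟩
  have hset : MeasurableSet {ω | ε / 2 ≤ |X n ω|} :=
    measurableSet_le measurable_const (hX n).abs
  have hXi : Integrable (X n) (μ n) := Integrable.of_bound (hX n).aestronglyMeasurable B
    (Eventually.of_forall fun ω => hB n ω)
  have hdom : Integrable (fun ω => ε / 2
      + {ω | ε / 2 ≤ |X n ω|}.indicator (fun _ => |B|) ω) (μ n) :=
    (integrable_const _).add ((integrable_const _).indicator hset)
  have hle : ∫ ω, |X n ω| ∂(μ n) ≤ ∫ ω, (ε / 2
      + {ω | ε / 2 ≤ |X n ω|}.indicator (fun _ => |B|) ω) ∂(μ n) := by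
    refine integral_mono hXi.abs hdom fun ω => ?_
    by_cases hω : ε / 2 ≤ |X n ω|
    · have hmem : ω ∈ {ω | ε / 2 ≤ |X n ω|} := hω
      simp only [Set.indicator_of_mem hmem]
      linarith [hB n ω, le_abs_self B]
    · have hmem : ω ∉ {ω | ε / 2 ≤ |X n ω|} := hω
      simp only [Set.indicator_of_notMem hmem]
      linarith
  rw [integral_add (integrable_const _) ((integrable_const _).indicator hset),
    integral_indicator_const _ hset] at hle
  simp only [integral_const, probReal_univ, smul_eq_mul, one_mul] at hle
  rw [Real.dist_eq, sub_zero]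
  have h1 := abs_integral_le_integral_abs (f := X n) (μ := μ n)
  have h2 := hN n hn.le
  linarith

end PolicyValue

/-! ### From consistency of the variance to convergence in distribution -/

theorem theorem6 {𝒵 : Type*} [MeasurableSpace 𝒵] {d r m : ℕ}
    -- weights, nuisance parameter space, surrogate loss, sieve basis and dimensions, estimators
    (W : Weights 𝒵 d r) (H : Set (Vec d → Vec r)) (φ : ℝ → ℝ)
    (p : ℕ → Vec d → ℝ) (k : ℕ → ℕ) (S : Estimators 𝒵 d r m)
    -- the sequence of data generating processes and the population objects they determine
    (P : ℕ → Measure (Obs 𝒵 d)) [∀ n, IsProbabilityMeasure (P n)]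
    (η₀ : ℕ → Vec d → Vec r) (gstar gk : ℕ → Vec d → ℝ) (T : ℕ → Set (Vec d → Vec r))
    (hmeas : MeasurabilityConditions W H p S)
    (hweights : WeightConditions W H P η₀)
    (hφ : SurrogateConditions φ)
    (hgstar : ∀ n, IsSurrogatePolicy W φ (P n) (η₀ n) (gstar n))
    (hfold : S.Balanced)
    (hrate : PolicyRate p k P gstar gk S)
    (hmargin : MarginCondition W P η₀)
    (hnuis : NuisanceRate W H P η₀ gk S T)
    (hbdd : BoundednessConditions W H P η₀) :
    -- convergence in distribution to `N(0, σ_v²)`, where `σ_v² = lim σ_{v,n}²`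
    (∀ v : ℝ≥0,
      Tendsto (fun n => scoreVar W (P n) (η₀ n) (gstar n)) atTop (𝓝 (v : ℝ)) →
      TendstoInDistribution
        (fun n (y : (Fin n → Obs 𝒵 d) × (Fin n → ℝ)) => bootStat W S (P n) n y.1 y.2)
        atTop (id : ℝ → ℝ)
        (fun n => (sampleLaw (P n) n).prod (multiplierLaw n)) (gaussianReal 0 v)) ∧
    -- the same without assuming that the variances converge
    (∀ f : ℝ →ᵇ ℝ, Tendsto (fun n =>
        (∫ y, f (bootStat W S (P n) n y.1 y.2) ∂((sampleLaw (P n) n).prod (multiplierLaw n)))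
          - ∫ t, f t ∂(gaussianReal 0 (scoreVar W (P n) (η₀ n) (gstar n)).toNNReal))
      atTop (𝓝 0)) ∧
    -- the same conditionally on the data, in probability
    (∀ (f : ℝ →ᵇ ℝ) (ε : ℝ), 0 < ε → Tendsto (fun n =>
        sampleLaw (P n) n {w | ε ≤ |(∫ δ, f (bootStat W S (P n) n w δ) ∂(multiplierLaw n))
          - ∫ t, f t ∂(gaussianReal 0 (scoreVar W (P n) (η₀ n) (gstar n)).toNNReal)|})
      atTop (𝓝 0)) := by
  have hvar := fun κ (hκ : 0 < κ) => tendsto_measure_scoreHat_variance hmeas hweights hφ hgstar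
    hrate hmargin hnuis hbdd (κ := κ) hκ
  obtain ⟨K, hK, hsc⟩ := exists_score_moments hmeas hweights hφ hgstar hnuis.mem hbdd hmargin
  have hv : ∀ n, 0 ≤ scoreVar W (P n) (η₀ n) (gstar n) ∧
      scoreVar W (P n) (η₀ n) (gstar n) ≤ 1 + K := fun n =>
    ⟨integral_nonneg fun _ => sq_nonneg _, (integrable_sq_of_integrable_pow_four (hsc n).1
      (hsc n).2.1 (hsc n).2.2.1).2⟩
  have hcond : ∀ (f : ℝ →ᵇ ℝ) (ε : ℝ), 0 < ε → Tendsto (fun n =>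
      sampleLaw (P n) n {w | ε ≤ |(∫ δ, f (bootStat W S (P n) n w δ) ∂(multiplierLaw n))
        - ∫ t, f t ∂(gaussianReal 0 (scoreVar W (P n) (η₀ n) (gstar n)).toNNReal)|})
      atTop (𝓝 0) := by
    intro f ε hε
    -- The variances `σ_v²` lie in `[0, 1 + K]` and the empirical ones within 1 of them on the good
    -- event. Uniform continuity on this interval gives one modulus for all `n`, even if `σ_v²` does
    -- not converge.
    have huc := (isCompact_Icc (a := (-1 : ℝ)) (b := K + 2)).uniformContinuousOn_of_continuous
      (continuous_integral_gaussianReal f).continuousOn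
    obtain ⟨κ, hκ, hκε⟩ := Metric.uniformContinuousOn_iff.1 huc ε hε
    refine tendsto_of_tendsto_of_tendsto_of_le_of_le tendsto_const_nhds
      (hvar (min κ 1) (lt_min hκ one_pos)) (fun _ => zero_le) fun n => measure_mono fun w hw => ?_
    have hw' : ε ≤ |(∫ δ, f (bootStat W S (P n) n w δ) ∂(multiplierLaw n))
        - ∫ t, f t ∂(gaussianReal 0 (scoreVar W (P n) (η₀ n) (gstar n)).toNNReal)| := hw
    rw [integral_bootStat] at hw'
    by_contra hlt
    have hlt' : |1 / (n : ℝ) * ∑ i, scoreHat W S n w i (w i) ^ 2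
      - scoreVar W (P n) (η₀ n) (gstar n)| < min κ 1 := not_le.1 hlt
    have h1 := abs_lt.1 (hlt'.trans_le (min_le_right _ _))
    have h2 := hv n
    have h3 := hκε _ ⟨by linarith, by linarith⟩ (scoreVar W (P n) (η₀ n) (gstar n))
      ⟨by linarith, by linarith⟩ (hlt'.trans_le (min_le_left _ _))
    exact absurd hw' (not_le.2 h3)
  have huncond : ∀ f : ℝ →ᵇ ℝ, Tendsto (fun n =>
        (∫ y, f (bootStat W S (P n) n y.1 y.2) ∂((sampleLaw (P n) n).prod (multiplierLaw n)))
          - ∫ t, f t ∂(gaussianReal 0 (scoreVar W (P n) (η₀ n) (gstar n)).toNNReal))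
      atTop (𝓝 0) := by
    intro f
    have hbound : ∀ v, |∫ t, f t ∂(gaussianReal 0 v)| ≤ ‖f‖ := fun v => by
      have := norm_integral_le_of_norm_le_const (μ := gaussianReal 0 v) (f := f) (C := ‖f‖)
        (Eventually.of_forall fun t => f.norm_coe_le_norm t)
      simpa using this
    have hmean := tendsto_integral_of_tendsto_measure (fun n => sampleLaw (P n) n)
      (fun n w => (∫ δ, f (bootStat W S (P n) n w δ) ∂(multiplierLaw n))
        - ∫ t, f t ∂(gaussianReal 0 (scoreVar W (P n) (η₀ n) (gstar n)).toNNReal))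
      (fun n => by
        simp_rw [integral_bootStat]
        refine Measurable.sub ?_ measurable_const
        exact (continuous_integral_gaussianReal f).measurable.comp
          ((Finset.measurable_sum _ fun i _ =>
            (measurable_scoreHat hmeas n i).pow_const 2).const_mul _))
      (‖f‖ + ‖f‖) (fun n w => by
        rw [integral_bootStat]
        exact (abs_sub _ _).trans (add_le_add (hbound _) (hbound _)))
      (hcond f)
    refine hmean.congr fun n => ?_
    have hm : Measurable fun y : (Fin n → Obs 𝒵 d) × (Fin n → ℝ) =>
        f (bootStat W S (P n) n y.1 y.2) :=
      f.continuous.measurable.comp (measurable_bootStat hmeas (P n) n)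
    have hint : Integrable (fun y : (Fin n → Obs 𝒵 d) × (Fin n → ℝ) =>
        f (bootStat W S (P n) n y.1 y.2)) ((sampleLaw (P n) n).prod (multiplierLaw n)) :=
      Integrable.of_bound hm.aestronglyMeasurable ‖f‖
        (Eventually.of_forall fun y => f.norm_coe_le_norm _)
    -- By Fubini the unconditional integral is the mean of the conditional one, so the difference is
    -- the mean of the bounded discrepancy already shown to vanish in probability.
    rw [integral_prod _ hint, integral_sub hint.integral_prod_left (integrable_const _)]
    simp
  refine ⟨fun v hv => ?_, huncond, hcond⟩
  have hae : ∀ n, AEMeasurable (fun y : (Fin n → Obs 𝒵 d) × (Fin n → ℝ) =>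
      bootStat W S (P n) n y.1 y.2) ((sampleLaw (P n) n).prod (multiplierLaw n)) :=
    fun n => (measurable_bootStat hmeas (P n) n).aemeasurable
  refine ⟨hae, aemeasurable_id, ?_⟩
  refine ProbabilityMeasure.tendsto_iff_forall_integral_tendsto.2 fun f => ?_
  change Tendsto (fun n => ∫ t, f t ∂(Measure.map (fun y : (Fin n → Obs 𝒵 d) × (Fin n → ℝ) =>
    bootStat W S (P n) n y.1 y.2) ((sampleLaw (P n) n).prod (multiplierLaw n)))) atTop
    (𝓝 (∫ t, f t ∂((gaussianReal 0 v).map id)))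
  -- When the variances converge, the moving Gaussian integral converges to the one at `v` by
  -- continuity, and the two limits add up.
  have hlim := (huncond f).add (((continuous_integral_gaussianReal f).tendsto (v : ℝ)).comp hv)
  rw [zero_add, Real.toNNReal_coe] at hlim
  rw [Measure.map_id]
  refine hlim.congr fun n => ?_
  rw [integral_map (hae n) f.continuous.aestronglyMeasurable]
  simp
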